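/- Let $n\ge 0$, $j\ge 1$, let $a=\mathrm{diag}(a_1,\dots,a_n)\in u(n)$ and let $b\in u(n)$ be a polynomial in $a$, $b=p(a)$ with $p\in\mathbb C[X]$. Let $\mathcal U_a^\perp\subset u(n)$ be the space of skew-Hermitian matrices orthogonal, for the trace form, to the centralizer of $a$ in $u(n)$. For a Schwartz function $v:\mathbb R\to\mathcal U_a^\perp$ let $Q_{b,0}(v)=b$, and let $Q_{b,k}(v)$, $k\ge 1$, be determined by $$(Q_{b,k}(v))_x+[v,Q_{b,k}(v)]=[Q_{b,k+1}(v),a]\quad(k\ge 0),\qquad \lim_{x\to-\infty}Q_{b,k}(v)(x)=0\quad(k\ge 1).$$ Let $\mathcal M_{a,b,j}$ be the set of smooth maps $u:\mathbb R^2\to\mathcal U_a^\perp$ such that $u(\cdot,t)$ is in the Schwartz class for every $t$ and $u_t=(Q_{b,j}(u))_x+[u,Q_{b,j}(u)]$, where $Q_{b,k}(u)(x,t)=Q_{b,k}(u(\cdot,t))(x)$. The trivialization of $u\in\mathcal M_{a,b,j}$ is the solution $E(x,t,\lambda)$, smooth in $(x,t)\in\mathbb R^2$ for each $\lambda\in\mathbb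 C$, of $$E_x=E\,(a\lambda+u),\qquad E_t=E\sum_{k=0}^{j}Q_{b,j-k}(u)\lambda^{k},\qquad E(0,0,\lambda)=I .$$ For $z\in\mathbb C\setminus\mathbb R$ and a Hermitian projection $\pi$ of $\mathbb C^n$ put $g_{z,\pi}(\lambda)=\pi+\frac{\lambda-z}{\lambda-\bar z}(I-\pi)$. Let $G_+$ be the group of entire maps $f:\mathbb C\to GL(n,\mathbb C)$ with $f(\bar\lambda)^*f(\lambda)=I$, and $G_-^m$ the group of rational maps $g$ with $g(\infty)=I$ and $g(\bar\lambda)^*g(\lambda)=I$. Let $u\in\mathcal M_{a,b,j}$, let $E$ be the trivialization of $u$, $z\in\mathbb C\setminus\mathbb R$, $V\subset\mathbb C^n$ a complex linear subspace, $\pi$ the Hermitian projection onto $V$, and $\tilde\pi(x,t)$ the Hermitian projection of $\mathbb C^n$ onto $E(x,t,z)^*(V)$. Then: 1. $\tilde u=u+(z-\bar z)[\tilde\pi,a]$ is again in $\mathcal M_{a,b,j}$. 2. $\tilde\pi$ is smooth on $\mathbb R^2$ and solves $$\tilde\pi_x+[az+u,\tilde\pi]=(\bar z-z)[\tilde\pi,a]\tilde\pi,\qquad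 \tilde\pi_t=\sum_{k=0}^{j}[\tilde\pi,Q_{b,j-k}(u)]\,(z+(\bar z-z)\tilde\pi)^k,$$ $$\tilde\pi^*=\tilde\pi,\qquad \tilde\pi^2=\tilde\pi,\qquad \tilde\pi(0,0)=\pi.$$ 3. The map $\tilde E(x,t,\lambda)=g_{z,\pi}(\lambda)E(x,t,\lambda)g_{z,\tilde\pi(x,t)}(\lambda)^{-1}$, $\lambda\ne z,\bar z$, extends over $\lambda=z,\bar z$ to the trivialization of $\tilde u$, and for all $(x,t)$ one has $g_{z,\pi}E(x,t)=\tilde E(x,t)\,g_{z,\tilde\pi(x,t)}$ with $\tilde E(x,t)\in G_+$ and $g_{z,\tilde\pi(x,t)}\in G_-^m$. -/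

import Mathlib

open scoped SchwartzMap ContDiff ComplexConjugate

/-- Complex `n × n` matrices; `u(n)` is `skewAdjoint (CMat n)`. -/
abbrev CMat (n : ℕ) : Type := Matrix (Fin n) (Fin n) ℂ

/-- The derivative of a matrix-valued function of a real variable, entry by entry. -/
noncomputable def matDeriv {n : ℕ} (f : ℝ → CMat n) (x : ℝ) : CMat n :=
  Matrix.of fun i k => deriv (fun y => f y i k) x

/-- Smoothness of a matrix-valued function of `(x, t) ∈ ℝ²`, entry by entry. -/
def MatSmooth {n : ℕ} (f : ℝ → ℝ → CMat n) : Prop :=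
  ∀ i k, ContDiff ℝ ∞ fun p : ℝ × ℝ => f p.1 p.2 i k

/-- `𝒰_a^⊥` for `𝒰 = u(n)`: the skew-Hermitian matrices which are orthogonal, with respect to the
trace form, to the centralizer `𝒰_a` of `a` in `u(n)`. -/
def unitaryPerp {n : ℕ} (a : CMat n) : Set (CMat n) :=
  {y | y ∈ skewAdjoint (CMat n) ∧
    ∀ x ∈ skewAdjoint (CMat n), Commute a x → Matrix.trace (x * y) = 0}

/-- The projection of `gl(n)` onto the centralizer of `a = diag(α)`, along the image of
`ad(a)`. -/
noncomputable def centralizerPart {n : ℕ} (α : Fin n → ℂ) (Y : CMat n) : CMat n :=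
  Matrix.of fun i k => if α i = α k then Y i k else 0

/-- The projection of `gl(n)` onto the image of `ad(a)`, `a = diag(α)`, along the centralizer of
`a`, followed by the inverse of `ad(a)` on that image. -/
noncomputable def adInv {n : ℕ} (α : Fin n → ℂ) (Y : CMat n) : CMat n :=
  Matrix.of fun i k => if α i = α k then 0 else (α i - α k)⁻¹ * Y i k

/-- The sequence `Q_{b,0}(v), Q_{b,1}(v), …` for `a = diag(α)`. It is the solution of
`(Q_k)_x + [v, Q_k] = [Q_{k+1}, a]`, `Q_0 = b`, with `Q_k → 0` as `x → -∞` for `k ≥ 1`: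
the part of `Q_{k+1}` in the image of `ad(a)` is
`P = -ad(a)⁻¹ ((Q_k)_x + [v, Q_k])`, and the part `T` in the centralizer of `a` is determined by
`T_x = -π₀ [v, P]` and `T → 0` as `x → -∞`. -/
noncomputable def fluxQ {n : ℕ} (α : Fin n → ℂ) (b : CMat n) (v : ℝ → CMat n) :
    ℕ → ℝ → CMat n
  | 0 => fun _ => b
  | k + 1 =>
    let P : ℝ → CMat n := fun y => -adInv α (matDeriv (fluxQ α b v k) y + ⁅v y, fluxQ α b v k y⁆)
    fun x => P x - Matrix.of fun i l => ∫ y in Set.Iic x, centralizerPart α ⁅v y, P y⁆ i l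

/-- `Q_{b,k}(u)` at `(x, t)` for a function `u` of `(x, t)`: the operator acts in the variable `x`
at fixed `t`. -/
noncomputable def fluxAt {n : ℕ} (α : Fin n → ℂ) (b : CMat n) (u : ℝ → ℝ → CMat n) (k : ℕ)
    (x t : ℝ) : CMat n :=
  fluxQ α b (fun y => u y t) k x

/-- `u ∈ ℳ_{a,b,j}`, `a = diag(α)`: `u` is a smooth map from `ℝ²` to `𝒰_a^⊥`, in the Schwartz class
in `x` for every `t`, and solves the `j`-th flow `u_t = (Q_{b,j}(u))_x + [u, Q_{b,j}(u)]`. -/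
structure IsFlowSolution {n : ℕ} (α : Fin n → ℂ) (b : CMat n) (j : ℕ)
    (u : ℝ → ℝ → CMat n) : Prop where
  smooth : MatSmooth u
  mem_perp : ∀ x t, u x t ∈ unitaryPerp (Matrix.diagonal α)
  schwartz : ∀ t i k, ∃ f : 𝓢(ℝ, ℂ), ∀ x, f x = u x t i k
  flow : ∀ x t, matDeriv (fun s => u x s) t =
    matDeriv (fun y => fluxAt α b u j y t) x + ⁅u x t, fluxAt α b u j x t⁆

/-- `E` is the trivialization of `u` normalized at `(0,0)`: `E_x = E (aξ + u)`,
`E_t = E (bξ^j + Q_{b,1}(u) ξ^{j-1} + ⋯ + Q_{b,j}(u))`, `E(0,0,ξ) = I`. -/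
structure IsTrivialization {n : ℕ} (α : Fin n → ℂ) (b : CMat n) (j : ℕ)
    (u : ℝ → ℝ → CMat n) (E : ℝ → ℝ → ℂ → CMat n) : Prop where
  smooth : ∀ ξ, MatSmooth fun x t => E x t ξ
  deriv_x : ∀ x t ξ, matDeriv (fun y => E y t ξ) x = E x t ξ * (ξ • Matrix.diagonal α + u x t)
  deriv_t : ∀ x t ξ, matDeriv (fun s => E x s ξ) t =
    E x t ξ * ∑ k ∈ Finset.range (j + 1), ξ ^ k • fluxAt α b u (j - k) x t
  init : ∀ ξ, E 0 0 ξ = 1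

/-- The matrix of the Hermitian (orthogonal) projection of `ℂⁿ` onto `V`. -/
noncomputable def hermProj {n : ℕ} (V : Submodule ℂ (EuclideanSpace ℂ (Fin n))) : CMat n :=
  (Matrix.toEuclideanCLM (n := Fin n) (𝕜 := ℂ)).symm V.starProjection

/-- The image `M(V)` of a subspace `V` of `ℂⁿ` under a matrix `M`. -/
noncomputable def imageSubspace {n : ℕ} (M : CMat n)
    (V : Submodule ℂ (EuclideanSpace ℂ (Fin n))) : Submodule ℂ (EuclideanSpace ℂ (Fin n)) :=
  V.map (Matrix.toEuclideanLin M)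

/-- The simple element `g_{z,π}(ξ) = π + (ξ - z)/(ξ - z̄) π^⊥`; it has a pole at `ξ = z̄`, where
the value of this function is meaningless. -/
noncomputable def simpleElement {n : ℕ} (z : ℂ) (π : CMat n) (ξ : ℂ) : CMat n :=
  π + ((ξ - z) / (ξ - conj z)) • (1 - π)

/-- `f ∈ G_+`: `f` is holomorphic on `ℂ` and satisfies the `U(n)`-reality condition (which forces
its values to be invertible). -/
def MemGPlus {n : ℕ} (f : ℂ → CMat n) : Prop :=
  (∀ i k, Differentiable ℂ fun ξ => f ξ i k) ∧ ∀ ξ, (f (conj ξ)).conjTranspose * f ξ = 1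

/-- `g ∈ G_-^m`: `g` is a rational map, equal to `q⁻¹ P` off the zeros of `q`, with `g(∞) = I`,
satisfying the `U(n)`-reality condition. The values of `g` at the zeros of `q` are ignored. -/
def MemGMinus {n : ℕ} (g : ℂ → CMat n) : Prop :=
  ∃ (q : Polynomial ℂ) (P : Matrix (Fin n) (Fin n) (Polynomial ℂ)), q ≠ 0 ∧
    (∀ ξ, q.eval ξ ≠ 0 → g ξ = (q.eval ξ)⁻¹ • P.map (Polynomial.eval ξ)) ∧
    Filter.Tendsto g (Filter.cocompact ℂ) (nhds 1) ∧
    ∀ ξ, q.eval ξ ≠ 0 → q.eval (conj ξ) ≠ 0 → (g (conj ξ)).conjTranspose * g ξ = 1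

/-- `ρ` is a smooth solution, with initial value `π`, of the pair of ordinary differential equations
`ρ_x + [az + u, ρ] = (z̄ - z)[ρ, a]ρ`, `ρ_t = ∑_{k=0}^j [ρ, Q_{b,j-k}(u)](z + (z̄ - z)ρ)^k`
in Hermitian projections. -/
structure IsProjectionSystemSolution {n : ℕ} (α : Fin n → ℂ) (b : CMat n) (j : ℕ)
    (u : ℝ → ℝ → CMat n) (z : ℂ) (π : CMat n) (ρ : ℝ → ℝ → CMat n) : Prop where
  smooth : MatSmooth ρ
  deriv_x : ∀ x t, matDeriv (fun y => ρ y t) x + ⁅z • Matrix.diagonal α + u x t, ρ x t⁆ =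
    (conj z - z) • (⁅ρ x t, Matrix.diagonal α⁆ * ρ x t)
  deriv_t : ∀ x t, matDeriv (fun s => ρ x s) t =
    ∑ k ∈ Finset.range (j + 1),
      ⁅ρ x t, fluxAt α b u (j - k) x t⁆ * (z • (1 : CMat n) + (conj z - z) • ρ x t) ^ k
  hermitian : ∀ x t, (ρ x t).conjTranspose = ρ x t
  idempotent : ∀ x t, ρ x t * ρ x t = ρ x t
  init : ρ 0 0 = π

/-!
Put `D = z + (z̄ - z)π̃`, so that `(ξ - z̄) g_{z,π̃}(ξ) = ξ - D`. Since `E(z)` is inverted by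
`E(z̄)^*`, the matrix `E(z)^* π E(z̄)` is an oblique projection with the same range as `π̃`. The
orthogonal projection onto the range of an oblique projection `p` is `p (p + p^* - 1)⁻¹`; hence `π̃`
is smooth, and differentiating the oblique projection gives the two equations for `π̃`. They say
exactly that the gauge transformation by `ξ - D` turns the flat connection
`(aξ + u) dx + (∑ Q_{b,j-k}(u) ξ^k) dt` into another one that is polynomial in `ξ`, with `u`
replaced by `ũ`. So `Ẽ` solves a linear system polynomial in `ξ` off `ξ = z, z̄`; solutions of
skew-Hermitian systems of this kind are locally Lipschitz in `ξ`, and therefore `Ẽ` extends across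
the two points.

The coefficients of the new `dt`-part satisfy the recursion for `Q_{b,k}(ũ)`, and they are these as
soon as they have the right limits at `x = -∞`. This, and `ũ` being Schwartz, both follow from the
rapid decay of `[π̃, a]`. Up to sign and rapidly decaying terms, the derivative of
`i (Im z) tr(a π̃)` along the `x`-equation dominates `|[π̃, a]|²`, while its distance to the
finitely many values it takes on projections commuting with `a` is at most of that order. A bounded
function with these two properties approaches one of the values rapidly, so `[π̃, a]` is rapidly
decreasing, and the `x`-equation carries this over to its derivatives.
-/

section LinearSystems

open Filter Topology Set Metric
open scoped NNReal

variable {W A : Type*} [NormedAddCommGroup W] [NormedSpace ℝ W] [NormedRing A]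

theorem hasFDerivAt_of_dense_param {P X Y : Type*} [TopologicalSpace P] [NormedAddCommGroup X]
    [NormedSpace ℝ X] [NormedAddCommGroup Y] [NormedSpace ℝ Y] {S : Set P} (hS : Dense S)
    {f : P → X → Y} {f' : P → X → X →L[ℝ] Y} (hf : Continuous fun p : P × X => f p.1 p.2)
    (hf' : Continuous fun p : P × X => f' p.1 p.2)
    (hderiv : ∀ ξ ∈ S, ∀ x, HasFDerivAt (f ξ) (f' ξ x) x) (ξ : P) (x : X) :
    HasFDerivAt (f ξ) (f' ξ x) x := by
  have hne := mem_closure_iff_nhdsWithin_neBot.mp (hS ξ)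
  have hlim : TendstoUniformlyOnFilter f' (f' ξ) (𝓝[S] ξ) (𝓝 x) := by
    rw [tendstoUniformlyOnFilter_iff_tendsto]
    have hpair : Continuous fun p : P × X => (f' ξ p.2, f' p.1 p.2) :=
      (hf'.comp (by fun_prop : Continuous fun p : P × X => (ξ, p.2))).prodMk hf'
    refine ((hpair.tendsto (ξ, x)).mono_right (nhds_le_uniformity _)).mono_left ?_
    rw [nhds_prod_eq]
    exact Filter.prod_mono nhdsWithin_le_nhds le_rfl
  refine hasFDerivAt_of_tendstoUniformlyOnFilter (f := f) hlim ?_ ?_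
  · exact eventually_of_mem (prod_mem_prod self_mem_nhdsWithin univ_mem) fun p hp => hderiv _ hp.1 _
  · exact .of_forall fun y => (hf.comp (.prodMk_left y)).continuousWithinAt

/-- The fundamental solution, normalized at the origin, of the linear system `dF = F Ω`, whose
independent variables form the vector `w`. -/
structure IsFundamentalSolution [NormedAlgebra ℝ A] (Ω : W → W →L[ℝ] A) (F : W → A) : Prop where
  hasFDerivAt : ∀ w, HasFDerivAt F (F w • Ω w) w
  map_zero : F 0 = 1

namespace IsFundamentalSolution

section Real

variable [NormedAlgebra ℝ A] {Ω : W → W →L[ℝ] A} {F : W → A}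

theorem differentiable (hF : IsFundamentalSolution Ω F) : Differentiable ℝ F :=
  fun w => (hF.hasFDerivAt w).differentiableAt

theorem contDiff_succ (hF : IsFundamentalSolution Ω F) {k : ℕ} (hΩ : ContDiff ℝ k Ω) :
    ContDiff ℝ (k + 1 : ℕ) F := by
  have hfderiv : fderiv ℝ F = fun w => (ContinuousLinearMap.mul ℝ A (F w)).comp (Ω w) :=
    funext fun w => (hF.hasFDerivAt w).fderiv
  have hstep : ∀ l : ℕ, l ≤ k → ContDiff ℝ l F → ContDiff ℝ (l + 1 : ℕ) F := fun l hl hFl => by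
    rw [Nat.cast_succ, contDiff_succ_iff_fderiv]
    refine ⟨hF.differentiable, by simp, ?_⟩
    rw [hfderiv]
    exact ((ContinuousLinearMap.mul ℝ A).contDiff.comp hFl).clm_comp
      (hΩ.of_le (by exact_mod_cast hl))
  have hall : ∀ l : ℕ, l ≤ k + 1 → ContDiff ℝ l F := fun l => by
    induction l with
    | zero => exact fun _ => contDiff_zero.mpr hF.differentiable.continuous
    | succ l ih => exact fun hl => hstep l (by omega) (ih (by omega))
  exact hall (k + 1) le_rfl

theorem contDiff (hF : IsFundamentalSolution Ω F) (hΩ : ContDiff ℝ ∞ Ω) : ContDiff ℝ ∞ F :=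
  contDiff_infty.mpr fun k =>
    (hF.contDiff_succ (contDiff_infty.mp hΩ k)).of_le (by exact_mod_cast Nat.le_succ k)

theorem hasDerivAt_ray (hF : IsFundamentalSolution Ω F) (w : W) (s : ℝ) :
    HasDerivAt (fun s : ℝ => F (s • w)) (F (s • w) * Ω (s • w) w) s := by
  have hray : HasDerivAt (fun s : ℝ => s • w) w s := by
    simpa using (hasDerivAt_id s).smul_const w
  exact (hF.hasFDerivAt (s • w)).comp_hasDerivAt s hray

theorem norm_le (hF : IsFundamentalSolution Ω F) {C R : ℝ}
    (hΩ : ∀ w, ‖w‖ ≤ R → ‖Ω w‖ ≤ C) {w : W} (hw : ‖w‖ ≤ R) :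
    ‖F w‖ ≤ ‖(1 : A)‖ * Real.exp (C * R) := by
  have hC : 0 ≤ C := (norm_nonneg _).trans (hΩ w hw)
  have hderiv : ∀ s ∈ Ico (0 : ℝ) 1,
      ‖F (s • w) * Ω (s • w) w‖ ≤ C * R * ‖F (s • w)‖ + 0 := fun s hs => by
    have hsw : ‖s • w‖ ≤ R := by
      rw [norm_smul, Real.norm_of_nonneg hs.1]
      exact (mul_le_of_le_one_left (norm_nonneg w) hs.2.le).trans hw
    calc ‖F (s • w) * Ω (s • w) w‖ ≤ ‖F (s • w)‖ * (‖Ω (s • w)‖ * ‖w‖) :=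
          (norm_mul_le _ _).trans (by gcongr; exact (Ω (s • w)).le_opNorm w)
      _ ≤ ‖F (s • w)‖ * (C * R) := by gcongr; exact hΩ _ hsw
      _ = C * R * ‖F (s • w)‖ + 0 := by ring
  have := norm_le_gronwallBound_of_norm_deriv_right_le (δ := ‖(1 : A)‖)
    (fun s _ => (hF.hasDerivAt_ray w s).continuousAt.continuousWithinAt)
    (fun s _ => (hF.hasDerivAt_ray w s).hasDerivWithinAt)
    (by rw [zero_smul, hF.map_zero]) hderiv 1 ⟨zero_le_one, le_rfl⟩
  simpa [gronwallBound_ε0] using this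

end Real

section Star

variable [NormedAlgebra ℂ A] [StarRing A] [NormedStarGroup A] [StarModule ℂ A]
  {Ω Ω' : W → W →L[ℝ] A} {F G : W → A}

theorem hasDerivAt_ray_mul_star (hF : IsFundamentalSolution Ω F)
    (hG : IsFundamentalSolution Ω' G) (w : W) (s : ℝ) :
    HasDerivAt (fun s : ℝ => F (s • w) * star (G (s • w)))
      (F (s • w) * (Ω (s • w) w + star (Ω' (s • w) w)) * star (G (s • w))) s := by
  convert (hF.hasDerivAt_ray w s).fun_mul (hG.hasDerivAt_ray w s).star using 1
  rw [star_mul, mul_add, add_mul, mul_assoc (F (s • w)) (star _)]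

theorem mul_star_eq_one (hF : IsFundamentalSolution Ω F) (hG : IsFundamentalSolution Ω' G)
    (hskew : ∀ w h, Ω w h + star (Ω' w h) = 0) (w : W) : F w * star (G w) = 1 := by
  have hderiv := hF.hasDerivAt_ray_mul_star hG w
  simp only [hskew, mul_zero, zero_mul] at hderiv
  simpa [hF.map_zero, hG.map_zero] using
    is_const_of_deriv_eq_zero (fun s => (hderiv s).differentiableAt) (fun s => (hderiv s).deriv) 1 0

variable [CompleteSpace A]

theorem mul_star_sub_one (hF : IsFundamentalSolution Ω F) (hG : IsFundamentalSolution Ω' G)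
    (hΩ : Continuous Ω) (hΩ' : Continuous Ω') (w : W) :
    F w * star (G w) - 1 = ∫ s in (0 : ℝ)..1,
      F (s • w) * (Ω (s • w) w + star (Ω' (s • w) w)) * star (G (s • w)) := by
  have hcont : Continuous fun s : ℝ =>
      F (s • w) * (Ω (s • w) w + star (Ω' (s • w) w)) * star (G (s • w)) := by
    have hF' := hF.differentiable.continuous
    have hG' := hG.differentiable.continuous
    fun_prop
  rw [intervalIntegral.integral_eq_sub_of_hasDerivAt
    (fun s _ => hF.hasDerivAt_ray_mul_star hG w s) (hcont.intervalIntegrable 0 1)]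
  simp [hF.map_zero, hG.map_zero]

end Star

end IsFundamentalSolution

section Pencil

variable [NormedAlgebra ℂ A] (Ω : ℕ → W → W →L[ℝ] A) (m : ℕ)

/-- The linear system whose coefficients are polynomials of degree less than `m` in the spectral
parameter `ξ`, `Ω k` being the coefficient of `ξ ^ k`. -/
noncomputable def pencil (ξ : ℂ) (w : W) : W →L[ℝ] A :=
  ∑ k ∈ Finset.range m, ξ ^ k • Ω k w

/-- The divided difference in `ξ` of `pencil Ω m`. -/
noncomputable def pencilSlope (ξ η : ℂ) (w : W) : W →L[ℝ] A :=
  ∑ k ∈ Finset.range m, (∑ i ∈ Finset.range k, ξ ^ i * η ^ (k - 1 - i)) • Ω k w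

variable {Ω}

theorem pencil_sub (ξ η : ℂ) (w : W) :
    pencil Ω m ξ w - pencil Ω m η w = (ξ - η) • pencilSlope Ω m ξ η w := by
  simp only [pencil, pencilSlope, Finset.smul_sum, ← Finset.sum_sub_distrib, smul_smul,
    (Commute.all ξ η).mul_geom_sum₂]
  exact Finset.sum_congr rfl fun _ _ => (sub_smul _ _ _).symm

theorem continuous_pencil (hΩ : ∀ k, Continuous (Ω k)) :
    Continuous fun p : ℂ × W => pencil Ω m p.1 p.2 := by
  unfold pencil
  fun_prop

theorem continuous_pencilSlope (hΩ : ∀ k, Continuous (Ω k)) :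
    Continuous fun p : (ℂ × ℂ) × W => pencilSlope Ω m p.1.1 p.1.2 p.2 := by
  unfold pencilSlope
  fun_prop

theorem pencil_add_star_pencil_conj [StarRing A] [StarModule ℂ A]
    (hskew : ∀ k w h, Ω k w h ∈ skewAdjoint A) (ξ : ℂ) (w h : W) :
    pencil Ω m ξ w h + star (pencil Ω m (conj ξ) w h) = 0 := by
  simp [pencil, star_sum, star_smul, skewAdjoint.mem_iff.mp (hskew _ w h)]

theorem contDiff_coeff_of_contDiff_pencil {r : WithTop ℕ∞} {m : ℕ}
    (h : ∀ ξ, ContDiff ℝ r (pencil Ω m ξ)) {k : ℕ} (hk : k < m) : ContDiff ℝ r (Ω k) := by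
  let v : Fin m → ℂ := fun p => (p : ℕ)
  have hv : Function.Injective v := Nat.cast_injective.comp Fin.val_injective
  have hdet : IsUnit (Matrix.vandermonde v).det :=
    isUnit_iff_ne_zero.mpr (Matrix.det_vandermonde_ne_zero_iff.mpr hv)
  have hΩ : Ω k = fun w => ∑ p, (Matrix.vandermonde v)⁻¹ ⟨k, hk⟩ p • pencil Ω m (v p) w := by
    funext w
    have hpencil : ∀ p, pencil Ω m (v p) w = ∑ l : Fin m, Matrix.vandermonde v p l • Ω l w :=
      fun p => Finset.sum_range _
    simp only [hpencil, Finset.smul_sum, smul_smul]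
    rw [Finset.sum_comm]
    simp only [← Finset.sum_smul, ← Matrix.mul_apply, Matrix.nonsing_inv_mul _ hdet,
      Matrix.one_apply, ite_smul, one_smul, zero_smul, Finset.sum_ite_eq, Finset.mem_univ, if_true]
  rw [hΩ]
  exact ContDiff.sum fun p _ => (h (v p)).const_smul _

theorem contDiff_coeff_of_isFundamentalSolution [StarRing A] [NormedStarGroup A] [StarModule ℂ A]
    [IsDedekindFiniteMonoid A] {m : ℕ} {F : ℂ → W → A} (hskew : ∀ k w h, Ω k w h ∈ skewAdjoint A)
    (hF : ∀ ξ, IsFundamentalSolution (pencil Ω m ξ) (F ξ)) (hF' : ∀ ξ, ContDiff ℝ ∞ (F ξ))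
    {k : ℕ} (hk : k < m) : ContDiff ℝ ∞ (Ω k) := by
  refine contDiff_coeff_of_contDiff_pencil (fun ξ => ?_) hk
  have hpencil : pencil Ω m ξ = fun w =>
      (ContinuousLinearMap.mul ℝ A (star (F (conj ξ) w))).comp (fderiv ℝ (F ξ) w) := by
    funext w
    have hinv : star (F (conj ξ) w) * F ξ w = 1 := mul_eq_one_comm.mp <|
      (hF ξ).mul_star_eq_one (hF _) (pencil_add_star_pencil_conj m hskew ξ) w
    refine ContinuousLinearMap.ext fun h => ?_
    simp [((hF ξ).hasFDerivAt w).fderiv, ← mul_assoc, hinv]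
  rw [hpencil]
  exact ((ContinuousLinearMap.mul ℝ A).contDiff.comp
    ((starL' ℝ : A ≃L[ℝ] A).contDiff.comp (hF' _))).clm_comp ((hF' ξ).fderiv_right le_rfl)

end Pencil

section SpectralFamily

variable [NormedAlgebra ℂ A] [StarRing A]

/-- `F ξ` is, for each spectral parameter `ξ ∈ S`, the fundamental solution of a pencil with
skew-adjoint coefficients. -/
structure IsSkewPencilSolution (Ω : ℕ → W → W →L[ℝ] A) (m : ℕ) (S : Set ℂ) (F : ℂ → W → A) :
    Prop where
  continuous_coeff : ∀ k, Continuous (Ω k)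
  skew_coeff : ∀ k w h, Ω k w h ∈ skewAdjoint A
  conj_mem : ∀ ξ ∈ S, conj ξ ∈ S
  solution : ∀ ξ ∈ S, IsFundamentalSolution (pencil Ω m ξ) (F ξ)

namespace IsSkewPencilSolution

variable {Ω : ℕ → W → W →L[ℝ] A} {m : ℕ} {S : Set ℂ} {F : ℂ → W → A} {ξ η : ℂ}

theorem continuous_pencil (h : IsSkewPencilSolution Ω m S F) (ξ : ℂ) :
    Continuous (pencil Ω m ξ) :=
  (_root_.continuous_pencil m h.continuous_coeff).comp (Continuous.prodMk_right ξ)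

theorem continuous (h : IsSkewPencilSolution Ω m S F) (hξ : ξ ∈ S) : Continuous (F ξ) :=
  (h.solution ξ hξ).differentiable.continuous

theorem exists_norm_le [ProperSpace W] (h : IsSkewPencilSolution Ω m S F) (R : ℝ) :
    ∃ C, ∀ ξ ∈ S ∩ closedBall 0 R, ∀ w ∈ closedBall (0 : W) R, ‖F ξ w‖ ≤ C := by
  obtain ⟨C, hC⟩ := ((isCompact_closedBall (0 : ℂ) R).prod (isCompact_closedBall (0 : W) R))
    |>.exists_bound_of_continuousOn (_root_.continuous_pencil m h.continuous_coeff).continuousOn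
  refine ⟨‖(1 : A)‖ * Real.exp (C * R), fun ξ hξ w hw => ?_⟩
  refine (h.solution ξ hξ.1).norm_le (fun w' hw' => ?_) (mem_closedBall_zero_iff.mp hw)
  exact hC (ξ, w') ⟨hξ.2, mem_closedBall_zero_iff.mpr hw'⟩

theorem exists_norm_integral_le [NormedStarGroup A] [ProperSpace W]
    (h : IsSkewPencilSolution Ω m S F) (R : ℝ) :
    ∃ C, ∀ ξ ∈ S ∩ closedBall 0 R, ∀ η ∈ S ∩ closedBall 0 R, ∀ w ∈ closedBall (0 : W) R,
      ‖∫ s in (0 : ℝ)..1,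
        F ξ (s • w) * pencilSlope Ω m ξ η (s • w) w * star (F (conj η) (s • w))‖ ≤ C := by
  obtain ⟨C, hC⟩ := h.exists_norm_le R
  obtain ⟨D, hD⟩ := (((isCompact_closedBall (0 : ℂ) R).prod (isCompact_closedBall (0 : ℂ) R)).prod
    (isCompact_closedBall (0 : W) R)).exists_bound_of_continuousOn
      (continuous_pencilSlope m h.continuous_coeff).continuousOn
  refine ⟨C * (D * R) * C, fun ξ hξ η hη w hw => ?_⟩
  have hwR := mem_closedBall_zero_iff.mp hw
  have hR₀ : 0 ≤ R := (norm_nonneg w).trans hwR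
  have hC₀ : 0 ≤ C := (norm_nonneg _).trans (hC ξ hξ w hw)
  have hD₀ : 0 ≤ D := (norm_nonneg _).trans (hD ((ξ, η), w) ⟨⟨hξ.2, hη.2⟩, hw⟩)
  have hηbar : conj η ∈ S ∩ closedBall 0 R := ⟨h.conj_mem η hη.1, by simpa using hη.2⟩
  have hbound : ∀ s ∈ uIoc (0 : ℝ) 1,
      ‖F ξ (s • w) * pencilSlope Ω m ξ η (s • w) w * star (F (conj η) (s • w))‖ ≤
        C * (D * R) * C := fun s hs => by
    rw [uIoc_of_le zero_le_one] at hs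
    have hsw : s • w ∈ closedBall (0 : W) R := by
      rw [mem_closedBall_zero_iff, norm_smul, Real.norm_of_nonneg hs.1.le]
      exact (mul_le_of_le_one_left (norm_nonneg w) hs.2).trans hwR
    have hslope : ‖pencilSlope Ω m ξ η (s • w) w‖ ≤ D * R :=
      (ContinuousLinearMap.le_opNorm _ _).trans (by
        gcongr
        exact hD ((ξ, η), s • w) ⟨⟨hξ.2, hη.2⟩, hsw⟩)
    refine norm_mul₃_le.trans ?_
    rw [norm_star]
    gcongr
    exacts [hC ξ hξ _ hsw, hC _ hηbar _ hsw]
  simpa using intervalIntegral.norm_integral_le_of_norm_le_const hbound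

variable [NormedStarGroup A] [StarModule ℂ A]

theorem mul_star_conj (h : IsSkewPencilSolution Ω m S F) (hξ : ξ ∈ S) (w : W) :
    F ξ w * star (F (conj ξ) w) = 1 :=
  (h.solution ξ hξ).mul_star_eq_one (h.solution _ (h.conj_mem ξ hξ))
    (pencil_add_star_pencil_conj m h.skew_coeff ξ) w

variable [IsDedekindFiniteMonoid A]

theorem star_conj_mul (h : IsSkewPencilSolution Ω m S F) (hξ : ξ ∈ S) (w : W) :
    star (F (conj ξ) w) * F ξ w = 1 :=
  mul_eq_one_comm.mp (h.mul_star_conj hξ w)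

variable [CompleteSpace A]

theorem sub_eq_smul_integral (h : IsSkewPencilSolution Ω m S F) (hξ : ξ ∈ S) (hη : η ∈ S)
    (w : W) :
    F ξ w - F η w = (ξ - η) • ((∫ s in (0 : ℝ)..1,
      F ξ (s • w) * pencilSlope Ω m ξ η (s • w) w * star (F (conj η) (s • w))) * F η w) := by
  have hsum : ∀ w' : W, pencil Ω m ξ w' w + star (pencil Ω m (conj η) w' w) =
      (ξ - η) • pencilSlope Ω m ξ η w' w := fun w' => by
    rw [← smul_apply, ← pencil_sub, sub_apply,
      sub_eq_add_neg, ← eq_neg_of_add_eq_zero_right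
        (pencil_add_star_pencil_conj m h.skew_coeff η w' w)]
  have hvar := (h.solution ξ hξ).mul_star_sub_one (h.solution _ (h.conj_mem η hη))
    (h.continuous_pencil ξ) (h.continuous_pencil _) w
  simp only [hsum, mul_smul_comm, smul_mul_assoc, intervalIntegral.integral_smul] at hvar
  rw [← smul_mul_assoc, ← hvar, sub_mul, mul_assoc, h.star_conj_mul hη, mul_one, one_mul]

variable [ProperSpace W]

theorem exists_lipschitzOnWith (h : IsSkewPencilSolution Ω m S F) (R : ℝ) :
    ∃ K : ℝ≥0, ∀ w ∈ closedBall (0 : W) R,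
      LipschitzOnWith K (fun ξ => F ξ w) (S ∩ closedBall 0 R) := by
  obtain ⟨C, hC⟩ := h.exists_norm_integral_le R
  obtain ⟨D, hD⟩ := h.exists_norm_le R
  refine ⟨(C * D).toNNReal, fun w hw => LipschitzOnWith.of_dist_le_mul fun ξ hξ η hη => ?_⟩
  have hC₀ : 0 ≤ C := (norm_nonneg _).trans (hC ξ hξ η hη w hw)
  have hD₀ : 0 ≤ D := (norm_nonneg _).trans (hD ξ hξ w hw)
  rw [Real.coe_toNNReal _ (by positivity), dist_eq_norm, dist_eq_norm,
    h.sub_eq_smul_integral hξ.1 hη.1, norm_smul, mul_comm]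
  gcongr
  exact (norm_mul_le _ _).trans (by gcongr; exacts [hC ξ hξ η hη w hw, hD η hη w hw])

theorem exists_nhds_lipschitzOnWith (h : IsSkewPencilSolution Ω m S F) (ξ : ℂ) (w : W) :
    ∃ K : ℝ≥0, ∃ U ∈ 𝓝 ξ, ∃ V ∈ 𝓝 w, IsOpen U ∧
      ∀ w' ∈ V, LipschitzOnWith K (fun ξ => F ξ w') (S ∩ U) := by
  set R := max ‖ξ‖ ‖w‖ + 1
  obtain ⟨K, hK⟩ := h.exists_lipschitzOnWith R
  have hξ : ‖ξ‖ < R := (le_max_left _ _).trans_lt (lt_add_one _)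
  have hw : ‖w‖ < R := (le_max_right _ _).trans_lt (lt_add_one _)
  exact ⟨K, ball 0 R, isOpen_ball.mem_nhds (by simpa using hξ), closedBall 0 R,
    closedBall_mem_nhds_of_mem (by simpa using hw), isOpen_ball, fun w' hw' =>
    (hK w' hw').mono (inter_subset_inter_right S ball_subset_closedBall)⟩

theorem continuousOn_param (h : IsSkewPencilSolution Ω m S F) (w : W) :
    ContinuousOn (fun ξ => F ξ w) S := fun ξ hξ => by
  obtain ⟨K, U, hU, V, hV, -, hK⟩ := h.exists_nhds_lipschitzOnWith ξ w
  exact (continuousWithinAt_inter hU).mp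
    ((hK w (mem_of_mem_nhds hV)).continuousOn ξ ⟨hξ, mem_of_mem_nhds hU⟩)

theorem exists_tendsto (h : IsSkewPencilSolution Ω m S F) (hS : Dense S) (ξ : ℂ) (w : W) :
    ∃ y, Tendsto (fun η => F η w) (𝓝[S] ξ) (𝓝 y) := by
  obtain ⟨K, U, hU, V, hV, -, hK⟩ := h.exists_nhds_lipschitzOnWith ξ w
  have hne := mem_closure_iff_nhdsWithin_neBot.mp (hS ξ)
  have hmem : S ∩ U ∈ 𝓝[S] ξ := inter_mem self_mem_nhdsWithin (mem_nhdsWithin_of_mem_nhds hU)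
  refine cauchy_map_iff_exists_tendsto.mp (cauchy_map_iff.mpr ⟨hne, ?_⟩)
  refine Tendsto.mono_left (hK w (mem_of_mem_nhds hV)).uniformContinuousOn (le_inf ?_ ?_)
  · exact (Filter.prod_mono nhdsWithin_le_nhds nhdsWithin_le_nhds).trans
      (nhds_prod_eq.symm.trans_le (nhds_le_uniformity ξ))
  · exact le_principal_iff.mpr (prod_mem_prod hmem hmem)

theorem continuous_extendFrom (h : IsSkewPencilSolution Ω m S F) (hS : Dense S) :
    Continuous fun p : ℂ × W => extendFrom S (fun η => F η p.2) p.1 := by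
  have hext : ∀ w, Continuous (extendFrom S fun η => F η w) := fun w =>
    _root_.continuous_extendFrom hS fun ξ => h.exists_tendsto hS ξ w
  have heq : ∀ w, ∀ ξ ∈ S, extendFrom S (fun η => F η w) ξ = F ξ w := fun w =>
    extendFrom_extends (h.continuousOn_param w)
  refine continuous_iff_continuousAt.mpr fun ⟨ξ, w⟩ => ?_
  obtain ⟨K, U, hU, V, hV, hUo, hK⟩ := h.exists_nhds_lipschitzOnWith ξ w
  have hdense : U ⊆ closure (S ∩ U) := fun η hη =>
    inter_comm S U ▸ hS.open_subset_closure_inter hUo hη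
  refine (continuousOn_prod_of_subset_closure_continuousOn_lipschitzOnWith _ inter_subset_right
    hdense K (fun η hη => ?_) (fun w' hw' => ?_)).continuousAt (prod_mem_nhds hU hV)
  · simpa only [heq _ η hη.1] using (h.continuous hη.1).continuousOn
  · have hlip : LipschitzOnWith K (extendFrom S fun η => F η w') (S ∩ U) := fun η hη η' hη' => by
      rw [heq w' η hη.1, heq w' η' hη'.1]
      exact hK w' hw' hη hη'
    exact (hlip.closure (hext w').continuousOn).mono hdense

theorem exists_extension (h : IsSkewPencilSolution Ω m S F) (hS : Dense S) :
    ∃ F', IsSkewPencilSolution Ω m univ F' ∧ ∀ ξ ∈ S, F' ξ = F ξ := by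
  let F' : ℂ → W → A := fun ξ w => extendFrom S (fun η => F η w) ξ
  have hF' : Continuous fun p : ℂ × W => F' p.1 p.2 := h.continuous_extendFrom hS
  have heq : ∀ ξ ∈ S, F' ξ = F ξ := fun ξ hξ => funext fun w =>
    extendFrom_extends (h.continuousOn_param w) ξ hξ
  have hcoeff : Continuous fun p : ℂ × W => F' p.1 p.2 • pencil Ω m p.1 p.2 :=
    ((ContinuousLinearMap.mul ℝ A).continuous.comp hF').clm_comp
      (_root_.continuous_pencil m h.continuous_coeff)
  refine ⟨F', ⟨h.continuous_coeff, h.skew_coeff, fun _ _ => mem_univ _, fun ξ _ =>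
    ⟨hasFDerivAt_of_dense_param (f' := fun η w => F' η w • pencil Ω m η w) hS hF' hcoeff
      (fun η hη w => ?_) ξ, ?_⟩⟩, heq⟩
  · rw [heq η hη]
    exact (h.solution η hη).hasFDerivAt w
  · have hconst : EqOn (fun η => F' η 0) (fun _ => 1) S := fun η hη => by
      simp only [heq η hη, (h.solution η hη).map_zero]
    exact congrFun ((hF'.comp (.prodMk_left 0)).ext_on hS continuous_const hconst) ξ

theorem continuous_uncurry (h : IsSkewPencilSolution Ω m univ F) :
    Continuous fun p : ℂ × W => F p.1 p.2 := by
  simpa only [extendFrom_extends (h.continuousOn_param _) _ (mem_univ _)] using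
    h.continuous_extendFrom dense_univ

theorem differentiable_param (h : IsSkewPencilSolution Ω m univ F) (w : W) :
    Differentiable ℂ fun ξ => F ξ w := fun η => by
  let g : ℂ → A := fun ξ => (∫ s in (0 : ℝ)..1,
    F ξ (s • w) * pencilSlope Ω m ξ η (s • w) w * star (F (conj η) (s • w))) * F η w
  have hg : Continuous g := by
    have hF := h.continuous_uncurry
    have hslope := continuous_pencilSlope m h.continuous_coeff
    refine (intervalIntegral.continuous_parametric_intervalIntegral_of_continuous' ?_ 0 1).mul
      continuous_const
    refine Continuous.mul (Continuous.mul (hF.comp (by fun_prop : Continuous fun p : ℂ × ℝ =>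
      (p.1, p.2 • w))) ?_) (hF.comp (by fun_prop : Continuous fun p : ℂ × ℝ =>
      (conj η, p.2 • w))).star
    exact (hslope.comp (by fun_prop : Continuous fun p : ℂ × ℝ => ((p.1, η), p.2 • w))).clm_apply
      continuous_const
  have hderiv : HasDerivAt (fun ξ => F ξ w) (g η) η := by
    refine hasDerivAt_iff_tendsto_slope.mpr ((hg.tendsto η).mono_left nhdsWithin_le_nhds
      |>.congr' (eventually_nhdsWithin_of_forall fun ξ hξ => ?_))
    rw [slope_def_module, h.sub_eq_smul_integral (mem_univ ξ) (mem_univ η),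
      inv_smul_smul₀ (sub_ne_zero.mpr hξ)]
  exact hderiv.differentiableAt

end IsSkewPencilSolution

end SpectralFamily

end LinearSystems

section RangeProjection

/-- `ρ` is the self-adjoint projection with the same range as the (oblique) projection `p`. -/
structure IsRangeProjection {A : Type*} [Mul A] [Star A] (p ρ : A) : Prop where
  star_eq : star ρ = ρ
  mul_left : ρ * p = p
  mul_right : p * ρ = ρ

namespace IsRangeProjection

section Semigroup

variable {A : Type*} [Semigroup A] [Star A] {p ρ : A}

theorem mul_self (h : IsRangeProjection p ρ) : ρ * ρ = ρ := by
  calc ρ * ρ = ρ * p * ρ := by rw [mul_assoc, h.mul_right]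
    _ = ρ := by rw [h.mul_left, h.mul_right]

theorem mul_self_left (h : IsRangeProjection p ρ) : p * p = p := by
  calc p * p = p * ρ * p := by rw [mul_assoc, h.mul_left]
    _ = p := by rw [h.mul_right, h.mul_left]

end Semigroup

theorem mul_add_star_sub_one {A : Type*} [Ring A] [StarRing A] {p ρ : A}
    (h : IsRangeProjection p ρ) : ρ * (p + star p - 1) = p := by
  have hstar : ρ * star p = ρ := by simpa [h.star_eq] using congrArg star h.mul_right
  rw [mul_sub, mul_add, h.mul_left, hstar, mul_one, add_sub_cancel_right]

variable {A : Type*} [CStarAlgebra A]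

theorem isUnit_add_star_sub_one {p : A} (hp : p * p = p) : IsUnit (p + star p - 1) := by
  have hsq : (p + star p - 1) ^ 2 = star (p - star p) * (p - star p) + 1 := by
    have hp' : star p * star p = star p := by rw [← star_mul, hp]
    simp only [sq, star_sub, star_star, mul_add, add_mul, mul_sub, sub_mul, mul_one, one_mul, hp,
      hp']
    abel
  have hspec : (-1 : ℝ) ∉ spectrum ℝ (star (p - star p) * (p - star p)) := fun hmem => by
    linarith [spectrum_star_mul_self_nonneg _ hmem]
  rw [spectrum.notMem_iff, ← IsUnit.neg_iff] at hspec
  refine (isUnit_pow_iff two_ne_zero).mp ?_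
  rwa [hsq, ← sub_neg_eq_add, ← neg_sub, ← map_one (algebraMap ℝ A), ← map_neg]

theorem eq_mul_inverse {p ρ : A} (h : IsRangeProjection p ρ) :
    ρ = p * Ring.inverse (p + star p - 1) := by
  rw [Ring.eq_mul_inverse_iff_mul_eq _ _ _ (isUnit_add_star_sub_one h.mul_self_left),
    h.mul_add_star_sub_one]

theorem contDiff {W : Type*} [NormedAddCommGroup W] [NormedSpace ℝ W] {m : WithTop ℕ∞}
    {p ρ : W → A} (h : ∀ w, IsRangeProjection (p w) (ρ w)) (hp : ContDiff ℝ m p) :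
    ContDiff ℝ m ρ := by
  rw [funext fun w => (h w).eq_mul_inverse]
  have hq : ContDiff ℝ m fun w => p w + star (p w) - 1 :=
    (hp.add ((starL' ℝ : A ≃L[ℝ] A).contDiff.comp hp)).sub contDiff_const
  refine hp.mul (contDiff_iff_contDiffAt.mpr fun w => ?_)
  obtain ⟨e, he⟩ := isUnit_add_star_sub_one (h w).mul_self_left
  have hinv : ContDiffAt ℝ m Ring.inverse (p w + star (p w) - 1) := he ▸ contDiffAt_ringInverse ℝ e
  exact hinv.comp w hq.contDiffAt

theorem hasDerivAt {p ρ : ℝ → A} {B : A} {x : ℝ} (h : ∀ y, IsRangeProjection (p y) (ρ y))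
    (hρ : DifferentiableAt ℝ ρ x) (hp : HasDerivAt p (star B * p x - p x * star B) x) :
    HasDerivAt ρ ((1 - ρ x) * star B * ρ x + ρ x * B * (1 - ρ x)) x := by
  obtain ⟨ρ', hρ'⟩ : ∃ ρ', HasDerivAt ρ ρ' x := ⟨_, hρ.hasDerivAt⟩
  have hleft : ρ' * p x = (1 - ρ x) * star B * p x := by
    have hprod := (hρ'.mul hp).unique (by simpa only [Pi.mul_def, (h _).mul_left] using hp)
    rw [eq_sub_of_add_eq hprod, mul_sub, ← mul_assoc, ← mul_assoc, (h x).mul_left]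
    noncomm_ring
  have hright : ρ' * ρ x = (1 - ρ x) * star B * ρ x := by
    calc ρ' * ρ x = ρ' * p x * ρ x := by rw [mul_assoc, (h x).mul_right]
      _ = (1 - ρ x) * star B * ρ x := by rw [hleft, mul_assoc, (h x).mul_right]
  have hstar : star ρ' = ρ' := hρ'.star.unique (by simpa only [(h _).star_eq] using hρ')
  have hleft' : ρ x * ρ' = ρ x * B * (1 - ρ x) := by
    simpa [hstar, (h x).star_eq, mul_assoc] using congrArg star hright
  have hsum := (hρ'.mul hρ').unique (by simpa only [Pi.mul_def, (h _).mul_self] using hρ')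
  rwa [← hright, ← hleft', hsum]

end IsRangeProjection

section HermProj

variable {n : ℕ} (V : Submodule ℂ (EuclideanSpace ℂ (Fin n)))

theorem toEuclideanCLM_hermProj :
    Matrix.toEuclideanCLM (n := Fin n) (𝕜 := ℂ) (hermProj V) = V.starProjection :=
  StarAlgEquiv.apply_symm_apply _ _

theorem isStarProjection_hermProj : IsStarProjection (hermProj V) := by
  let T := Matrix.toEuclideanCLM (n := Fin n) (𝕜 := ℂ)
  refine ⟨EquivLike.injective T ?_, EquivLike.injective T ?_⟩
  · rw [map_mul, toEuclideanCLM_hermProj]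
    exact V.isIdempotentElem_starProjection
  · rw [map_star, toEuclideanCLM_hermProj]
    exact isSelfAdjoint_starProjection V

theorem isRangeProjection_hermProj {M N : CMat n} (hNM : N * M = 1) :
    IsRangeProjection (M * hermProj V * N) (hermProj (imageSubspace M V)) := by
  let T := Matrix.toEuclideanCLM (n := Fin n) (𝕜 := ℂ)
  have hmem : ∀ v ∈ V, T M v ∈ imageSubspace M V := fun v hv => Submodule.mem_map_of_mem hv
  refine ⟨(isStarProjection_hermProj _).isSelfAdjoint,
    EquivLike.injective T (ContinuousLinearMap.ext fun v => ?_),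
    EquivLike.injective T (ContinuousLinearMap.ext fun v => ?_)⟩
  · simp only [map_mul, T, toEuclideanCLM_hermProj, mul_apply_eq_comp]
    exact Submodule.starProjection_eq_self_iff.mpr (hmem _ (V.starProjection_apply_mem _))
  · obtain ⟨w, hw, hwv⟩ := (imageSubspace M V).starProjection_apply_mem v
    have hNMw : T N (T M w) = w := by
      rw [← mul_apply_eq_comp, ← map_mul, hNM, map_one, one_apply_eq_self]
    simp only [map_mul, T, toEuclideanCLM_hermProj, mul_apply_eq_comp]
    change T M (V.starProjection (T N ((imageSubspace M V).starProjection v))) = _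
    rw [← hwv]
    change T M (V.starProjection (T N (T M w))) = T M w
    rw [hNMw, Submodule.starProjection_eq_self_iff.mpr hw]

end HermProj

end RangeProjection

section DressFactor

variable {R : Type*} [Ring R] [Algebra ℂ R]

/-- The constant term of the linear factor `ξ - dressFactor z ρ = (ξ - z̄) g_{z,ρ}(ξ)`; it acts as
`z` on the kernel of the projection `ρ` and as `z̄` on its range. -/
noncomputable def dressFactor (z : ℂ) (ρ : R) : R :=
  z • (1 : R) + (conj z - z) • ρ

theorem dressFactor_pow {ρ : R} (hρ : ρ * ρ = ρ) (z : ℂ) (k : ℕ) :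
    dressFactor z ρ ^ k = conj z ^ k • ρ + z ^ k • (1 - ρ) := by
  induction k with
  | zero => simp
  | succ k ih =>
    rw [pow_succ, ih, dressFactor]
    simp only [add_mul, mul_add, sub_mul, smul_mul_assoc, mul_smul_comm, smul_sub, one_mul,
      mul_one, hρ, pow_succ]
    module

theorem lie_mul_dressFactor_pow {ρ : R} (hρ : ρ * ρ = ρ) (C : R) (z : ℂ) (k : ℕ) :
    ⁅ρ, C⁆ * dressFactor z ρ ^ k =
      z ^ k • (ρ * C * (1 - ρ)) - conj z ^ k • ((1 - ρ) * C * ρ) := by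
  have hCρρ : C * ρ * ρ = C * ρ := by rw [mul_assoc, hρ]
  rw [dressFactor_pow hρ, Ring.lie_def]
  simp only [mul_add, sub_mul, mul_sub, mul_smul_comm, smul_sub, one_mul, mul_one, hCρρ]
  module

theorem dressFactor_lie (z : ℂ) (ρ C : R) :
    ⁅dressFactor z ρ, C⁆ = (conj z - z) • ⁅ρ, C⁆ := by
  simp only [dressFactor, Ring.lie_def, add_mul, mul_add, smul_mul_assoc, mul_smul_comm, one_mul,
    mul_one, smul_sub]
  abel

theorem lie_dressFactor (z : ℂ) (C ρ : R) :
    ⁅C, dressFactor z ρ⁆ = (z - conj z) • ⁅ρ, C⁆ := by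
  have h := dressFactor_lie z ρ C
  rw [Ring.lie_def, ← neg_sub, ← Ring.lie_def, h, ← neg_smul, neg_sub]

theorem sub_dressFactor_mul_sub_dressFactor {ρ : R} (hρ : ρ * ρ = ρ) (z ξ : ℂ) :
    (ξ • 1 - dressFactor z ρ) * (ξ • 1 - dressFactor (conj z) ρ) =
      ((ξ - z) * (ξ - conj z)) • (1 : R) := by
  simp only [dressFactor, Complex.conj_conj, sub_mul, mul_sub, add_mul, mul_add, smul_mul_assoc,
    mul_smul_comm, one_mul, mul_one, hρ]
  module

theorem isUnit_sub_dressFactor {ρ : R} (hρ : ρ * ρ = ρ) {z ξ : ℂ}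
    (hξ : (ξ - z) * (ξ - conj z) ≠ 0) : IsUnit (ξ • 1 - dressFactor z ρ) := by
  have hunit : IsUnit (((ξ - z) * (ξ - conj z)) • (1 : R)) := by
    rw [← Algebra.algebraMap_eq_smul_one]
    exact (IsUnit.mk0 _ hξ).map (algebraMap ℂ R)
  have hcomm : Commute (ξ • 1 - dressFactor z ρ) (ξ • 1 - dressFactor (conj z) ρ) := by
    have hswap := sub_dressFactor_mul_sub_dressFactor hρ (conj z) ξ
    rw [Complex.conj_conj, mul_comm (ξ - conj z)] at hswap
    exact (sub_dressFactor_mul_sub_dressFactor hρ z ξ).trans hswap.symm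
  rw [← sub_dressFactor_mul_sub_dressFactor hρ] at hunit
  exact (hcomm.isUnit_mul_iff.mp hunit).1

section Star

variable [StarRing R] [StarModule ℂ R]

theorem star_pencil_conj_mul_add {ρ : R} (hρ : ρ * ρ = ρ) {C : ℕ → R}
    (hC : ∀ k, C k ∈ skewAdjoint R) (z : ℂ) (m : ℕ) :
    (1 - ρ) * star (∑ k ∈ Finset.range m, z ^ k • C k) * ρ +
        ρ * (∑ k ∈ Finset.range m, z ^ k • C k) * (1 - ρ) =
      ∑ k ∈ Finset.range m, ⁅ρ, C k⁆ * dressFactor z ρ ^ k := by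
  simp only [lie_mul_dressFactor_pow hρ, star_sum, star_smul, skewAdjoint.mem_iff.mp (hC _),
    star_pow, mul_neg, neg_mul, smul_neg, Finset.mul_sum, Finset.sum_mul, mul_smul_comm,
    smul_mul_assoc, Finset.sum_sub_distrib, Finset.sum_neg_distrib, RCLike.star_def]
  abel

theorem lie_dressFactor_mul_pow_mem_skewAdjoint {ρ C : R} (hs : star ρ = ρ) (hρ : ρ * ρ = ρ)
    (hC : C ∈ skewAdjoint R) (z : ℂ) (k : ℕ) :
    ⁅dressFactor z ρ, C⁆ * dressFactor z ρ ^ k ∈ skewAdjoint R := by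
  rw [dressFactor_lie, smul_mul_assoc, lie_mul_dressFactor_pow hρ, skewAdjoint.mem_iff]
  simp only [star_smul, star_sub, star_mul, star_one, hs, star_pow, RCLike.star_def,
    Complex.conj_conj, skewAdjoint.mem_iff.mp hC, mul_assoc, mul_neg, neg_mul]
  module

end Star

end DressFactor

section DressCoeff

/-- The coefficient of `ξ ^ k` in `((ξ - a) C(ξ) + ∑ k, [a, C k] a ^ k) (ξ - a)⁻¹`, for the
polynomial `C(ξ) = ∑ k < m, ξ ^ k C k`. -/
def dressCoeff {R : Type*} [Ring R] (a : R) (C : ℕ → R) (m k : ℕ) : R :=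
  C k - ∑ l ∈ Finset.range (m - (k + 1)), ⁅a, C (k + 1 + l)⁆ * a ^ l

variable {R : Type*} [Ring R] [Algebra ℂ R]

theorem sum_pow_smul_dressCoeff (a : R) (C : ℕ → R) (m : ℕ) (ξ : ℂ) :
    ∑ k ∈ Finset.range m, ξ ^ k • dressCoeff a C m k =
      ∑ k ∈ Finset.range m, (ξ ^ k • C k -
        ⁅a, C k⁆ * ∑ i ∈ Finset.range k, (ξ • 1) ^ i * a ^ (k - 1 - i)) := by
  have hswap : ∑ i ∈ Finset.range m, ξ ^ i • ∑ k ∈ Finset.Ico (i + 1) m,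
      ⁅a, C k⁆ * a ^ (k - 1 - i) =
      ∑ k ∈ Finset.range m, ⁅a, C k⁆ * ∑ i ∈ Finset.range k, (ξ • 1) ^ i * a ^ (k - 1 - i) := by
    simp only [Finset.smul_sum, Finset.mul_sum, smul_pow, one_pow, smul_mul_assoc, one_mul,
      mul_smul_comm]
    exact Finset.sum_comm' fun i k => by simp only [Finset.mem_range, Finset.mem_Ico]; omega
  simp only [dressCoeff, smul_sub, Finset.sum_sub_distrib]
  rw [← hswap]
  refine congrArg _ (Finset.sum_congr rfl fun i _ => congrArg _ ?_)
  rw [Finset.sum_Ico_eq_sum_range]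
  exact Finset.sum_congr rfl fun l _ => by rw [show i + 1 + l - 1 - i = l by omega]

theorem sum_dressCoeff_mul_sub (a : R) (C : ℕ → R) (m : ℕ) (ξ : ℂ) :
    (∑ k ∈ Finset.range m, ξ ^ k • dressCoeff a C m k) * (ξ • 1 - a) =
      (ξ • 1 - a) * ∑ k ∈ Finset.range m, ξ ^ k • C k +
        ∑ k ∈ Finset.range m, ⁅a, C k⁆ * a ^ k := by
  rw [sum_pow_smul_dressCoeff, Finset.sum_mul, Finset.mul_sum, ← Finset.sum_add_distrib]
  refine Finset.sum_congr rfl fun k _ => ?_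
  have hcomm : Commute (ξ • (1 : R)) a := (Commute.one_left a).smul_left ξ
  rw [sub_mul, mul_assoc, hcomm.geom_sum₂_mul, smul_pow, one_pow, Ring.lie_def]
  simp only [mul_sub, sub_mul, smul_mul_assoc, mul_smul_comm, mul_one, one_mul, smul_sub]
  module

theorem dressCoeff_mem_skewAdjoint [StarRing R] [StarModule ℂ R] {ρ : R} (hs : star ρ = ρ)
    (hρ : ρ * ρ = ρ) {C : ℕ → R} (hC : ∀ k, C k ∈ skewAdjoint R) (z : ℂ) (m k : ℕ) :
    dressCoeff (dressFactor z ρ) C m k ∈ skewAdjoint R :=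
  sub_mem (hC k) (sum_mem fun _ _ => lie_dressFactor_mul_pow_mem_skewAdjoint hs hρ (hC _) z _)

end DressCoeff

section DressPencil

open Set

variable {W A : Type*}

section Pencil

variable [NormedAddCommGroup W] [NormedSpace ℝ W]

/-- The coefficients of the pencil which the simple element with pole `z̄` and projection `ρ w`
produces, by its gauge action, from the pencil with coefficients `Ω k`, `k < m`. -/
noncomputable def dressPencil [NormedRing A] [NormedAlgebra ℂ A] (z : ℂ) (ρ : W → A)
    (Ω : ℕ → W → W →L[ℝ] A) (m k : ℕ) (w : W) : W →L[ℝ] A :=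
  let a := dressFactor z (ρ w)
  Ω k w - ∑ l ∈ Finset.range (m - (k + 1)),
    ((ContinuousLinearMap.mul ℝ A).flip (a ^ l)).comp
      ((ContinuousLinearMap.mul ℝ A a - (ContinuousLinearMap.mul ℝ A).flip a).comp
        (Ω (k + 1 + l) w))

variable [NormedRing A] [NormedAlgebra ℂ A]

theorem dressPencil_apply (z : ℂ) (ρ : W → A) (Ω : ℕ → W → W →L[ℝ] A) (m k : ℕ) (w h : W) :
    dressPencil z ρ Ω m k w h = dressCoeff (dressFactor z (ρ w)) (fun i => Ω i w h) m k := by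
  simp [dressPencil, dressCoeff, Ring.lie_def, sub_mul]

theorem contDiff_dressPencil {r : WithTop ℕ∞} {z : ℂ} {ρ : W → A} {Ω : ℕ → W → W →L[ℝ] A}
    (hρ : ContDiff ℝ r ρ) (hΩ : ∀ k, ContDiff ℝ r (Ω k)) (m k : ℕ) :
    ContDiff ℝ r (dressPencil z ρ Ω m k) := by
  have ha : ContDiff ℝ r fun w => dressFactor z (ρ w) :=
    contDiff_const.add (hρ.const_smul _)
  have hleft := (ContinuousLinearMap.mul ℝ A).contDiff.comp ha
  have hright := (ContinuousLinearMap.mul ℝ A).flip.contDiff.comp ha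
  refine (hΩ k).sub (ContDiff.sum fun l _ => ContDiff.clm_comp ?_ ((hleft.sub hright).clm_comp
    (hΩ _)))
  exact (ContinuousLinearMap.mul ℝ A).flip.contDiff.comp (ha.pow l)

theorem pencil_dressPencil_mul_sub (z : ℂ) (ρ : W → A) (Ω : ℕ → W → W →L[ℝ] A) (m : ℕ) (ξ : ℂ)
    (w h : W) :
    pencil (dressPencil z ρ Ω m) m ξ w h * (ξ • 1 - dressFactor z (ρ w)) =
      (ξ • 1 - dressFactor z (ρ w)) * pencil Ω m ξ w h +
        ∑ k ∈ Finset.range m, ⁅dressFactor z (ρ w), Ω k w h⁆ * dressFactor z (ρ w) ^ k := by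
  simpa [pencil, dressPencil_apply] using
    sum_dressCoeff_mul_sub (dressFactor z (ρ w)) (fun k => Ω k w h) m ξ

end Pencil

/-- For each `w`, `ρ w` is the self-adjoint projection onto `F z w*(V)`, where `V` is the range of
the self-adjoint projection `p`. The space `F z w*(V)` is represented by an oblique projection onto
it: for a pencil with skew-adjoint coefficients, `F z̄ w` is the inverse of `F z w*`. -/
structure IsDressingProjection [Ring A] [StarRing A] (F : ℂ → W → A) (z : ℂ) (p : A) (ρ : W → A) :
    Prop where
  isStarProjection : IsStarProjection p
  isRangeProjection : ∀ w, IsRangeProjection (star (F z w) * p * F (conj z) w) (ρ w)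

namespace IsDressingProjection

variable [CStarAlgebra A] {F : ℂ → W → A} {z : ℂ} {p : A} {ρ : W → A}

theorem star_eq (hρ : IsDressingProjection F z p ρ) (w : W) : star (ρ w) = ρ w :=
  (hρ.isRangeProjection w).star_eq

theorem mul_self (hρ : IsDressingProjection F z p ρ) (w : W) : ρ w * ρ w = ρ w :=
  (hρ.isRangeProjection w).mul_self

variable [NormedAddCommGroup W] [NormedSpace ℝ W] {Ω : ℕ → W → W →L[ℝ] A} {m : ℕ}

theorem map_zero (hρ : IsDressingProjection F z p ρ) (h : IsSkewPencilSolution Ω m univ F) :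
    ρ 0 = p := by
  have hrange := hρ.isRangeProjection 0
  simp only [(h.solution _ (mem_univ _)).map_zero, star_one, one_mul, mul_one] at hrange
  have hstar := congrArg star hrange.mul_right
  rw [star_mul, hrange.star_eq, hρ.isStarProjection.isSelfAdjoint.star_eq] at hstar
  rw [← hstar, hrange.mul_left]

theorem contDiff {r : WithTop ℕ∞} (hρ : IsDressingProjection F z p ρ)
    (hF : ∀ ξ, ContDiff ℝ r (F ξ)) : ContDiff ℝ r ρ :=
  IsRangeProjection.contDiff hρ.isRangeProjection <|
    (((starL' ℝ : A ≃L[ℝ] A).contDiff.comp (hF z)).mul contDiff_const).mul (hF (conj z))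

theorem differentiable (hρ : IsDressingProjection F z p ρ) (h : IsSkewPencilSolution Ω m univ F) :
    Differentiable ℝ ρ :=
  (hρ.contDiff fun ξ => (h.solution ξ (mem_univ ξ)).contDiff_succ (k := 0)
    (contDiff_zero.mpr (h.continuous_pencil ξ))).differentiable (by simp)

theorem hasDerivAt_comp (hρ : IsDressingProjection F z p ρ) (h : IsSkewPencilSolution Ω m univ F)
    {c : ℝ → W} {c' : W} {s : ℝ} (hc : HasDerivAt c c' s) :
    HasDerivAt (fun s => ρ (c s))
      (∑ k ∈ Finset.range m,
        ⁅ρ (c s), Ω k (c s) c'⁆ * dressFactor z (ρ (c s)) ^ k) s := by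
  have hF : ∀ ξ, HasDerivAt (fun s => F ξ (c s)) (F ξ (c s) * pencil Ω m ξ (c s) c') s := fun ξ =>
    ((h.solution ξ (mem_univ ξ)).hasFDerivAt (c s)).comp_hasDerivAt s hc
  have hstar : pencil Ω m (conj z) (c s) c' = -star (pencil Ω m z (c s) c') := by
    have := pencil_add_star_pencil_conj m h.skew_coeff (conj z) (c s) c'
    rwa [Complex.conj_conj, add_eq_zero_iff_eq_neg] at this
  have hp := ((hF z).star.mul_const p).fun_mul (hF (conj z))
  rw [hstar] at hp
  have key := IsRangeProjection.hasDerivAt (B := pencil Ω m z (c s) c')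
    (fun y => hρ.isRangeProjection (c y)) ((hρ.differentiable h (c s)).comp s hc.differentiableAt)
    (hp.congr_deriv (by rw [star_mul]; noncomm_ring))
  convert key using 1
  rw [← star_pencil_conj_mul_add (hρ.mul_self _) fun k => h.skew_coeff k (c s) c']
  simp [pencil]

theorem hasFDerivAt_dressFactor (hρ : IsDressingProjection F z p ρ)
    (h : IsSkewPencilSolution Ω m univ F) (w : W) :
    ∃ D : W →L[ℝ] A, HasFDerivAt (fun w => dressFactor z (ρ w)) D w ∧
      ∀ v, D v =
        ∑ k ∈ Finset.range m, ⁅dressFactor z (ρ w), Ω k w v⁆ * dressFactor z (ρ w) ^ k := by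
  have hρ' := (hρ.differentiable h w).hasFDerivAt
  refine ⟨_, (hρ'.const_smul (conj z - z)).const_add (z • (1 : A)), fun v => ?_⟩
  have hline : HasDerivAt (fun s : ℝ => w + s • v) v 0 := by
    simpa using ((hasDerivAt_id (0 : ℝ)).smul_const v).const_add w
  have hcomp : HasDerivAt (fun s : ℝ => ρ (w + s • v)) (fderiv ℝ ρ w v) 0 :=
    (by simpa using hρ' : HasFDerivAt ρ (fderiv ℝ ρ w) (w + (0 : ℝ) • v)).comp_hasDerivAt 0 hline
  have hv := hcomp.unique (hρ.hasDerivAt_comp h hline)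
  simp only [zero_smul, add_zero] at hv
  simp only [smul_apply, hv, Finset.smul_sum, dressFactor_lie, smul_mul_assoc]

theorem dressPencil_mem_skewAdjoint (hρ : IsDressingProjection F z p ρ)
    (h : IsSkewPencilSolution Ω m univ F) (k : ℕ) (w v : W) :
    dressPencil z ρ Ω m k w v ∈ skewAdjoint A := by
  rw [dressPencil_apply]
  exact dressCoeff_mem_skewAdjoint (hρ.star_eq w) (hρ.mul_self w)
    (fun i => h.skew_coeff i w v) z m k

theorem differentiable_intertwiner (hρ : IsDressingProjection F z p ρ)
    (h : IsSkewPencilSolution Ω m univ F) {ξ : ℂ} {F' : W → A} (hξ : (ξ - z) * (ξ - conj z) ≠ 0)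
    (hF' : ∀ w, (ξ • 1 - dressFactor z p) * F ξ w = F' w * (ξ • 1 - dressFactor z (ρ w))) :
    Differentiable ℝ F' := by
  have hF'_eq : F' = fun w => ((ξ - z) * (ξ - conj z))⁻¹ •
      ((ξ • 1 - dressFactor z p) * F ξ w * (ξ • 1 - dressFactor (conj z) (ρ w))) := by
    funext w
    rw [hF', mul_assoc, sub_dressFactor_mul_sub_dressFactor (hρ.mul_self w), mul_smul_comm,
      mul_one, inv_smul_smul₀ hξ]
  have hρd := hρ.differentiable h
  have hF := (h.solution ξ (mem_univ ξ)).differentiable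
  rw [hF'_eq]
  unfold dressFactor
  fun_prop

theorem isFundamentalSolution_intertwiner (hρ : IsDressingProjection F z p ρ)
    (h : IsSkewPencilSolution Ω m univ F) {ξ : ℂ} {F' : W → A} (hξ : (ξ - z) * (ξ - conj z) ≠ 0)
    (hF' : ∀ w, (ξ • 1 - dressFactor z p) * F ξ w = F' w * (ξ • 1 - dressFactor z (ρ w))) :
    IsFundamentalSolution (pencil (dressPencil z ρ Ω m) m ξ) F' := by
  have hunit : ∀ w, IsUnit (ξ • 1 - dressFactor z (ρ w)) := fun w =>
    isUnit_sub_dressFactor (hρ.mul_self w) hξ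
  refine ⟨fun w => ?_, ?_⟩
  · have hF'd := (hρ.differentiable_intertwiner h hξ hF' w).hasFDerivAt
    obtain ⟨D, hD, hDv⟩ := hρ.hasFDerivAt_dressFactor h w
    have hright := hF'd.mul' (hD.const_sub (ξ • (1 : A)))
    have hleft := ((h.solution ξ (mem_univ ξ)).hasFDerivAt w).const_mul (ξ • 1 - dressFactor z p)
    refine hF'd.congr_fderiv (ContinuousLinearMap.ext fun v => (hunit w).mul_right_cancel ?_)
    have hv := DFunLike.congr_fun (hright.unique (by simpa only [Pi.mul_def, ← hF'] using hleft)) v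
    simp only [add_apply, smul_apply, neg_apply, smul_eq_mul, MulOpposite.smul_eq_mul_unop,
      MulOpposite.unop_op, mul_neg] at hv ⊢
    rw [neg_add_eq_iff_eq_add] at hv
    rw [hv, mul_assoc (F' w), pencil_dressPencil_mul_sub, ← hDv, mul_add, ← mul_assoc (F' w),
      ← hF', mul_assoc, add_comm]
  · refine (hunit 0).mul_right_cancel ?_
    rw [← hF', hρ.map_zero h, (h.solution ξ (mem_univ ξ)).map_zero, mul_one, one_mul]

theorem exists_intertwiner (hρ : IsDressingProjection F z p ρ)
    (h : IsSkewPencilSolution Ω m univ F) [ProperSpace W] [IsDedekindFiniteMonoid A] :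
    ∃ F', IsSkewPencilSolution (dressPencil z ρ Ω m) m univ F' ∧ ∀ ξ w,
      (ξ • 1 - dressFactor z p) * F ξ w = F' ξ w * (ξ • 1 - dressFactor z (ρ w)) := by
  let S : Set ℂ := {z, conj z}ᶜ
  have hS : Dense S := (toFinite {z, conj z}).countable.dense_compl ℝ
  have hne : ∀ ξ ∈ S, (ξ - z) * (ξ - conj z) ≠ 0 := fun ξ hξ => by
    simp only [S, mem_compl_iff, mem_insert_iff, mem_singleton_iff, not_or] at hξ
    exact mul_ne_zero (sub_ne_zero.mpr hξ.1) (sub_ne_zero.mpr hξ.2)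
  have hSconj : ∀ ξ ∈ S, conj ξ ∈ S := fun ξ hξ => by
    simp only [S, mem_compl_iff, mem_insert_iff, mem_singleton_iff, not_or] at hξ ⊢
    exact ⟨fun h => hξ.2 (by rw [← h, Complex.conj_conj]), fun h => hξ.1 (star_injective h)⟩
  let G : ℂ → W → A := fun ξ w =>
    (ξ • 1 - dressFactor z p) * F ξ w * Ring.inverse (ξ • 1 - dressFactor z (ρ w))
  have hG : ∀ ξ ∈ S, ∀ w,
      (ξ • 1 - dressFactor z p) * F ξ w = G ξ w * (ξ • 1 - dressFactor z (ρ w)) := fun ξ hξ w =>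
    (Ring.inverse_mul_cancel_right _ _ (isUnit_sub_dressFactor (hρ.mul_self w) (hne ξ hξ))).symm
  have hcoeff := fun k => (contDiff_dressPencil (r := 0) (z := z)
    (contDiff_zero.mpr (hρ.differentiable h).continuous)
    (fun k => contDiff_zero.mpr (h.continuous_coeff k)) m k).continuous
  have hGsol : IsSkewPencilSolution (dressPencil z ρ Ω m) m S G :=
    ⟨hcoeff, hρ.dressPencil_mem_skewAdjoint h, hSconj, fun ξ hξ =>
      hρ.isFundamentalSolution_intertwiner h (hne ξ hξ) (hG ξ hξ)⟩
  obtain ⟨F', hF', hF'G⟩ := hGsol.exists_extension hS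
  refine ⟨F', hF', fun ξ w => ?_⟩
  have hFc := (h.differentiable_param w).continuous
  have hF'c := (hF'.differentiable_param w).continuous
  refine congrFun (Continuous.ext_on (f := fun ξ => (ξ • 1 - dressFactor z p) * F ξ w)
    (g := fun ξ => F' ξ w * (ξ • 1 - dressFactor z (ρ w))) hS (by fun_prop) (by fun_prop)
    fun η hη => ?_) ξ
  simp only [hF'G η hη]
  exact hG η hη w

end IsDressingProjection

end DressPencil

section Schwartz

open Filter Topology MeasureTheory

variable {V V' : Type*} [NormedAddCommGroup V] [NormedSpace ℝ V] [NormedAddCommGroup V']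
  [NormedSpace ℝ V']

/-- `f` is the underlying function of a Schwartz function on the line. -/
def IsSchwartz (f : ℝ → V) : Prop :=
  ∃ F : 𝓢(ℝ, V), ⇑F = f

namespace IsSchwartz

variable {f g : ℝ → V}

theorem add (hf : IsSchwartz f) (hg : IsSchwartz g) : IsSchwartz fun x => f x + g x := by
  obtain ⟨F, rfl⟩ := hf
  obtain ⟨G, rfl⟩ := hg
  exact ⟨F + G, rfl⟩

theorem clm_apply (L : V →L[ℝ] V') (hf : IsSchwartz f) : IsSchwartz fun x => L (f x) := by
  obtain ⟨F, rfl⟩ := hf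
  exact ⟨F.postcompCLM L, rfl⟩

theorem neg (hf : IsSchwartz f) : IsSchwartz fun x => -f x := by
  obtain ⟨F, rfl⟩ := hf
  exact ⟨-F, rfl⟩

theorem comp_neg (hf : IsSchwartz f) : IsSchwartz fun x => f (-x) := by
  obtain ⟨F, rfl⟩ := hf
  exact ⟨SchwartzMap.compCLMOfContinuousLinearEquiv ℝ (ContinuousLinearEquiv.neg ℝ) F, rfl⟩

theorem sum {ι : Type*} (s : Finset ι) {f : ι → ℝ → V} (hf : ∀ i, IsSchwartz (f i)) :
    IsSchwartz fun x => ∑ i ∈ s, f i x := by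
  choose F hF using hf
  exact ⟨∑ i ∈ s, F i, funext fun x => by simp [← hF]⟩

theorem deriv (hf : IsSchwartz f) : IsSchwartz (deriv f) := by
  obtain ⟨F, rfl⟩ := hf
  exact ⟨SchwartzMap.derivCLM ℝ V F, rfl⟩

theorem hasDerivAt (hf : IsSchwartz f) (x : ℝ) : HasDerivAt f (_root_.deriv f x) x := by
  obtain ⟨F, rfl⟩ := hf
  exact F.differentiableAt.hasDerivAt

theorem hasTemperateGrowth (hf : IsSchwartz f) : f.HasTemperateGrowth := by
  obtain ⟨F, rfl⟩ := hf
  exact F.hasTemperateGrowth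

theorem contDiff (hf : IsSchwartz f) : ContDiff ℝ ∞ f := hf.hasTemperateGrowth.1

theorem integrable (hf : IsSchwartz f) : Integrable f := by
  obtain ⟨F, rfl⟩ := hf
  exact F.integrable

theorem tendsto_atBot (hf : IsSchwartz f) : Tendsto f atBot (𝓝 0) := by
  obtain ⟨F, rfl⟩ := hf
  exact F.tendsto_cocompact.mono_left atBot_le_cocompact

theorem exists_bound (hf : IsSchwartz f) : ∃ C, ∀ x, ‖f x‖ ≤ C := by
  obtain ⟨F, rfl⟩ := hf
  obtain ⟨C, -, hC⟩ := F.decay 0 0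
  exact ⟨C, fun x => by simpa using hC x⟩

theorem lie {A : Type*} [NormedRing A] [NormedAlgebra ℝ A] {f g : ℝ → A} (hf : IsSchwartz f)
    (hg : g.HasTemperateGrowth) : IsSchwartz fun x => ⁅f x, g x⁆ := by
  obtain ⟨F, rfl⟩ := hf
  let B : A →L[ℝ] A →L[ℝ] A := ContinuousLinearMap.mul ℝ A - (ContinuousLinearMap.mul ℝ A).flip
  exact ⟨SchwartzMap.bilinLeftCLM B hg F, funext fun x => by simp [B, Ring.lie_def]⟩

theorem hasTemperateGrowth_of_hasDerivAt (hg : IsSchwartz g) (h : ∀ x, HasDerivAt f (g x) x) :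
    f.HasTemperateGrowth := by
  obtain ⟨C, hC⟩ := hg.exists_bound
  let e : V ≃L[ℝ] (ℝ →L[ℝ] V) := ContinuousLinearMap.toSpanSingletonCLE
  have hfderiv : fderiv ℝ f = fun x => e (g x) := funext fun x => (h x).hasFDerivAt.fderiv
  refine .of_fderiv (k := 1) (C := ‖f 0‖ + C) ?_ (fun x => (h x).differentiableAt) fun x => ?_
  · rw [hfderiv]
    exact (hg.clm_apply e.toContinuousLinearMap).hasTemperateGrowth
  · have hmvt := convex_univ.norm_image_sub_le_of_norm_hasDerivWithin_le
      (fun y _ => (h y).hasDerivWithinAt) (fun y _ => hC y) (Set.mem_univ 0) (Set.mem_univ x)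
    have htri := norm_le_norm_add_norm_sub' (f x) (f 0)
    have hC0 := (norm_nonneg (g 0)).trans (hC 0)
    rw [sub_zero] at hmvt
    nlinarith [norm_nonneg (f 0), norm_nonneg x]

theorem hasDerivAt_integral_Iic [CompleteSpace V] (hf : IsSchwartz f) (x : ℝ) :
    HasDerivAt (fun x => ∫ y in Set.Iic x, f y) (f x) x := by
  have hi := hf.integrable
  have hc := hf.contDiff.continuous
  have heq : (fun x => ∫ y in Set.Iic x, f y) =
      fun x => (∫ y in (0 : ℝ)..x, f y) + ∫ y in Set.Iic (0 : ℝ), f y := funext fun x => by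
    rw [← intervalIntegral.integral_Iic_sub_Iic hi.integrableOn hi.integrableOn, sub_add_cancel]
  rw [heq]
  exact (hc.integral_hasStrictDerivAt 0 x).hasDerivAt.add_const _

end IsSchwartz

end Schwartz

section Flux

open Filter Topology

section DressFlux

variable {R : Type*} [Ring R]

/-- The coefficient of `ξ ^ (-k)` in `(ξ - g) Q(ξ) (ξ - g)⁻¹` completed to a formal power series in
`ξ⁻¹` with the same leading term as `Q(ξ) = ∑ k, ξ ^ (-k) Q k`. -/
def dressFlux (g : R) (Q : ℕ → R) : ℕ → R
  | 0 => Q 0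
  | k + 1 => Q (k + 1) + dressFlux g Q k * g - g * Q k

theorem dressFlux_eq_sub_sum (g : R) (Q : ℕ → R) (k : ℕ) :
    dressFlux g Q k = Q k - ∑ l ∈ Finset.range k, ⁅g, Q (k - 1 - l)⁆ * g ^ l := by
  induction k with
  | zero => simp [dressFlux]
  | succ k ih =>
    have hshift : ∑ l ∈ Finset.range k, ⁅g, Q (k - (l + 1))⁆ * g ^ (l + 1) =
        (∑ l ∈ Finset.range k, ⁅g, Q (k - 1 - l)⁆ * g ^ l) * g := by
      simp only [Finset.sum_mul, pow_succ, mul_assoc, Nat.sub_sub, add_comm]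
    rw [dressFlux, ih, Finset.sum_range_succ']
    rw [Nat.add_sub_cancel, hshift, Nat.sub_zero, pow_zero, mul_one, Ring.lie_def, sub_mul]
    abel

theorem mul_sub_dressFlux_mul (g : R) (Q : ℕ → R) (k : ℕ) :
    g * Q k - dressFlux g Q k * g =
      ∑ l ∈ Finset.range (k + 1), ⁅g, Q (k - l)⁆ * g ^ l := by
  have h := dressFlux_eq_sub_sum g Q (k + 1)
  rw [dressFlux, add_sub_assoc, sub_eq_add_neg (Q (k + 1)), add_left_cancel_iff] at h
  rw [← neg_sub, h, neg_neg, Nat.add_sub_cancel]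

theorem dressCoeff_eq_dressFlux (g : R) (Q : ℕ → R) (j i : ℕ) :
    dressCoeff g (fun i => Q (j - i)) (j + 1) i = dressFlux g Q (j - i) := by
  rw [dressCoeff, dressFlux_eq_sub_sum, Nat.add_sub_add_right]
  exact congrArg _ <| Finset.sum_congr rfl fun l _ => by
    rw [show j - (i + 1 + l) = j - i - 1 - l by omega]

end DressFlux

variable {A : Type*} [NormedRing A] [NormedAlgebra ℝ A]

/-- `Q` is the sequence `Q_{b,0}(v), Q_{b,1}(v), …` generated by `v`, for the operator `a`. -/
structure IsFluxSequence (a b : A) (v : ℝ → A) (Q : ℕ → ℝ → A) : Prop where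
  zero : Q 0 = fun _ => b
  hasDerivAt : ∀ k x, HasDerivAt (Q k) (⁅Q (k + 1) x, a⁆ - ⁅v x, Q k x⁆) x
  tendsto : ∀ k, Tendsto (Q (k + 1)) atBot (𝓝 0)

namespace IsFluxSequence

variable {a b : A} {v : ℝ → A} {Q : ℕ → ℝ → A}

theorem neg_star [StarRing A] [ContinuousStar A] [StarModule ℝ A] (ha : a ∈ skewAdjoint A)
    (hb : b ∈ skewAdjoint A) (hv : ∀ x, v x ∈ skewAdjoint A) (h : IsFluxSequence a b v Q) :
    IsFluxSequence a b v fun k x => -star (Q k x) := by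
  have hv' : ∀ x, star (v x) = -v x := fun x => skewAdjoint.mem_iff.mp (hv x)
  refine ⟨?_, fun k x => (h.hasDerivAt k x).star.fun_neg.congr_deriv ?_, fun k => ?_⟩
  · simp [h.zero, skewAdjoint.mem_iff.mp hb]
  · simp only [Ring.lie_def, star_sub, star_mul, hv', skewAdjoint.mem_iff.mp ha]
    noncomm_ring
  · simpa using (h.tendsto k).star.neg

section Dress

variable {g : ℝ → A} (h : IsFluxSequence a b v Q) (hab : Commute a b)
  (hg : ∀ x, HasDerivAt g (g x * v x - (v x + ⁅a, g x⁆) * g x) x)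

include h hab hg

theorem hasDerivAt_dressFlux (k : ℕ) (x : ℝ) :
    HasDerivAt (fun x => dressFlux (g x) (Q · x) k)
      (⁅dressFlux (g x) (Q · x) (k + 1), a⁆ -
        ⁅v x + ⁅a, g x⁆, dressFlux (g x) (Q · x) k⁆) x := by
  induction k with
  | zero =>
    have hQ := h.hasDerivAt 0 x
    refine hQ.congr_deriv ?_
    simp only [dressFlux, h.zero, Ring.lie_def]
    linear_combination (norm := noncomm_ring) hab.eq * g x - g x * hab.eq
  | succ k ih =>
    have hd := ((h.hasDerivAt (k + 1) x).add (ih.mul (hg x))).sub ((hg x).mul (h.hasDerivAt k x))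
    refine hd.congr_deriv ?_
    simp only [dressFlux, Ring.lie_def]
    noncomm_ring

theorem dress (hbdd : ∃ C, ∀ x, ‖g x‖ ≤ C) (hlim : Tendsto (fun x => ⁅b, g x⁆) atBot (𝓝 0)) :
    IsFluxSequence a b (fun x => v x + ⁅a, g x⁆) fun k x => dressFlux (g x) (Q · x) k := by
  refine ⟨by simp [dressFlux, h.zero], h.hasDerivAt_dressFlux hab hg, fun k => ?_⟩
  induction k with
  | zero =>
    simpa [dressFlux, h.zero, Ring.lie_def, add_sub_assoc] using (h.tendsto 0).add hlim
  | succ k ih =>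
    have hgO : IsBoundedUnder (· ≤ ·) atBot fun x => ‖g x‖ :=
      isBoundedUnder_of hbdd
    simpa [dressFlux] using ((h.tendsto (k + 1)).add (ih.zero_mul_isBoundedUnder_le hgO)).sub
      (isBoundedUnder_le_mul_tendsto_zero hgO (h.tendsto k))

end Dress

end IsFluxSequence

end Flux

section MatrixFlux

open Filter Topology MeasureTheory
open scoped Matrix.Norms.L2Operator

variable {n : ℕ}

section Entries

/-- The `(i, k)` entry, as a continuous real-linear functional. -/
noncomputable def entryCLM (i k : Fin n) : CMat n →L[ℝ] ℂ :=
  (Matrix.entryLinearMap ℂ ℂ i k).toContinuousLinearMap.restrictScalars ℝ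

/-- The inclusion of `ℂ` as the `(i, k)` entry, as a continuous real-linear map. -/
noncomputable def singleCLM (i k : Fin n) : ℂ →L[ℝ] CMat n :=
  (Matrix.singleLinearMap ℂ i k).toContinuousLinearMap.restrictScalars ℝ

theorem sum_singleCLM_entryCLM (M : CMat n) :
    ∑ i, ∑ k, singleCLM i k (entryCLM i k M) = M :=
  (Matrix.matrix_eq_sum_single M).symm

theorem matSmooth_iff_contDiff {f : ℝ → ℝ → CMat n} :
    MatSmooth f ↔ ContDiff ℝ ∞ fun p : ℝ × ℝ => f p.1 p.2 := by
  refine ⟨fun h => ?_, fun h i k => (entryCLM i k).contDiff.comp h⟩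
  rw [funext fun p : ℝ × ℝ => (sum_singleCLM_entryCLM (f p.1 p.2)).symm]
  exact ContDiff.sum fun i _ => ContDiff.sum fun k _ => (singleCLM i k).contDiff.comp (h i k)

theorem isSchwartz_iff_entry {f : ℝ → CMat n} :
    IsSchwartz f ↔ ∀ i k, ∃ F : 𝓢(ℝ, ℂ), ∀ x, F x = f x i k := by
  refine ⟨fun h i k => ?_, fun h => ?_⟩
  · obtain ⟨F, hF⟩ := h.clm_apply (entryCLM i k)
    exact ⟨F, congrFun hF⟩
  · rw [funext fun x => (sum_singleCLM_entryCLM (f x)).symm]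
    refine IsSchwartz.sum _ fun i => IsSchwartz.sum _ fun k => ?_
    obtain ⟨F, hF⟩ := h i k
    exact IsSchwartz.clm_apply (f := fun x => entryCLM i k (f x)) _ ⟨F, funext hF⟩

theorem matDeriv_eq {f : ℝ → CMat n} {f' : CMat n} {x : ℝ} (h : HasDerivAt f f' x) :
    matDeriv f x = f' :=
  Matrix.ext fun i k => ((entryCLM i k).hasFDerivAt.comp_hasDerivAt x h).deriv

theorem of_integral_entry {f : ℝ → CMat n} {μ : Measure ℝ} (hf : Integrable f μ) :
    (Matrix.of fun i k => ∫ y, f y i k ∂μ) = ∫ y, f y ∂μ :=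
  Matrix.ext fun i k => (entryCLM i k).integral_comp_comm hf

end Entries

section CentralizerPart

variable (α : Fin n → ℂ)

theorem lie_diagonal_apply (X : CMat n) (i k : Fin n) :
    ⁅X, Matrix.diagonal α⁆ i k = (α k - α i) * X i k := by
  rw [Ring.lie_def, Matrix.sub_apply, Matrix.mul_diagonal, Matrix.diagonal_mul]
  ring

/-- `centralizerPart α` as a continuous real-linear map. -/
noncomputable def centralizerPartCLM : CMat n →L[ℝ] CMat n :=
  ({ toFun := centralizerPart α
     map_add' := fun X Y => by ext i k; by_cases h : α i = α k <;> simp [centralizerPart, h]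
     map_smul' := fun c X => by ext i k; by_cases h : α i = α k <;> simp [centralizerPart, h] } :
    CMat n →ₗ[ℂ] CMat n).toContinuousLinearMap.restrictScalars ℝ

/-- `adInv α` as a continuous real-linear map. -/
noncomputable def adInvCLM : CMat n →L[ℝ] CMat n :=
  ({ toFun := adInv α
     map_add' := fun X Y => by ext i k; by_cases h : α i = α k <;> simp [adInv, h, mul_add]
     map_smul' := fun c X => by
      ext i k; by_cases h : α i = α k <;> simp [adInv, h, mul_left_comm] } :
    CMat n →ₗ[ℂ] CMat n).toContinuousLinearMap.restrictScalars ℝ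

variable {α} {X Y : CMat n}

theorem centralizerPart_add :
    centralizerPart α (X + Y) = centralizerPart α X + centralizerPart α Y :=
  map_add (centralizerPartCLM α) X Y

theorem centralizerPart_sub :
    centralizerPart α (X - Y) = centralizerPart α X - centralizerPart α Y :=
  map_sub (centralizerPartCLM α) X Y

theorem centralizerPart_lie_diagonal : centralizerPart α ⁅X, Matrix.diagonal α⁆ = 0 := by
  ext i k
  by_cases h : α i = α k <;> simp [centralizerPart, lie_diagonal_apply, h]

theorem centralizerPart_of_commute (h : Commute X (Matrix.diagonal α)) :
    centralizerPart α X = X := by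
  ext i k
  have hik := lie_diagonal_apply α X i k
  rw [commute_iff_lie_eq.mp h, Matrix.zero_apply, zero_eq_mul, sub_eq_zero] at hik
  by_cases hα : α i = α k
  · simp [centralizerPart, hα]
  · simp [centralizerPart, hα, hik.resolve_left (Ne.symm hα)]

theorem commute_centralizerPart (X : CMat n) :
    Commute (centralizerPart α X) (Matrix.diagonal α) := by
  rw [commute_iff_lie_eq]
  ext i k
  by_cases h : α i = α k <;> simp [centralizerPart, lie_diagonal_apply, h]

theorem lie_neg_adInv_diagonal (X : CMat n) :
    ⁅-adInv α X, Matrix.diagonal α⁆ = X - centralizerPart α X := by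
  ext i k
  by_cases h : α i = α k
  · simp [lie_diagonal_apply, adInv, centralizerPart, h]
  · have hinv : (α k - α i) * (α i - α k)⁻¹ = -1 := by
      rw [← neg_sub, neg_mul, mul_inv_cancel₀ (sub_ne_zero.mpr h)]
    simp [lie_diagonal_apply, adInv, centralizerPart, h, ← mul_assoc, hinv]

theorem centralizerPart_adInv (X : CMat n) : centralizerPart α (adInv α X) = 0 := by
  ext i k
  by_cases h : α i = α k <;> simp [centralizerPart, adInv, h]

theorem centralizerPart_lie_of_commute (hX : Commute X (Matrix.diagonal α))
    (hY : centralizerPart α Y = 0) : centralizerPart α ⁅Y, X⁆ = 0 := by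
  obtain ⟨P, rfl⟩ : ∃ P, Y = ⁅P, Matrix.diagonal α⁆ :=
    ⟨-adInv α Y, by rw [lie_neg_adInv_diagonal, hY, sub_zero]⟩
  have hjacobi : ⁅⁅P, Matrix.diagonal α⁆, X⁆ = ⁅⁅P, X⁆, Matrix.diagonal α⁆ := by
    simp only [Ring.lie_def]
    linear_combination (norm := noncomm_ring) hX.eq * P - P * hX.eq
  rw [hjacobi, centralizerPart_lie_diagonal]

end CentralizerPart

section FluxSequence

variable {α : Fin n → ℂ} {b : CMat n} {v : ℝ → CMat n}

theorem IsFluxSequence.unique (hv : ∀ x, centralizerPart α (v x) = 0) {Q R : ℕ → ℝ → CMat n}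
    (hQ : IsFluxSequence (Matrix.diagonal α) b v Q)
    (hR : IsFluxSequence (Matrix.diagonal α) b v R) : Q = R := by
  funext k
  induction k with
  | zero => rw [hQ.zero, hR.zero]
  | succ k ih =>
    have hcomm : ∀ x, Commute (Q (k + 1) x - R (k + 1) x) (Matrix.diagonal α) := fun x => by
      have hlie := (hQ.hasDerivAt k x).unique (ih ▸ hR.hasDerivAt k x)
      rw [sub_left_inj] at hlie
      rw [commute_iff_lie_eq, Ring.lie_def, sub_mul, mul_sub, sub_sub_sub_comm, ← Ring.lie_def,
        ← Ring.lie_def, hlie, sub_self]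
    have hderiv : ∀ x, HasDerivAt (fun x => Q (k + 1) x - R (k + 1) x) 0 x := fun x => by
      have hd := (hQ.hasDerivAt (k + 1) x).sub (hR.hasDerivAt (k + 1) x)
      have hd' := (centralizerPartCLM α).hasFDerivAt.comp_hasDerivAt x hd
      refine (hd'.congr_deriv ?_).congr_of_eventuallyEq (.of_forall fun y =>
        (centralizerPart_of_commute (hcomm y)).symm)
      change centralizerPart α _ = 0
      have hlie : ⁅v x, Q (k + 1) x⁆ - ⁅v x, R (k + 1) x⁆ = ⁅v x, Q (k + 1) x - R (k + 1) x⁆ := by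
        simp only [Ring.lie_def]
        noncomm_ring
      rw [sub_sub_sub_comm, hlie]
      simp only [centralizerPart_sub, centralizerPart_lie_diagonal, sub_self,
        centralizerPart_lie_of_commute (hcomm x) (hv x)]
    have hconst := is_const_of_deriv_eq_zero (fun x => (hderiv x).differentiableAt)
      fun x => (hderiv x).deriv
    funext x
    refine sub_eq_zero.mp (tendsto_nhds_unique (f := fun _ : ℝ => Q (k + 1) x - R (k + 1) x)
      tendsto_const_nhds (l := atBot) ?_)
    have hlim := (hQ.tendsto k).sub (hR.tendsto k)
    rw [sub_zero] at hlim
    exact hlim.congr fun y => hconst y x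

/-- `q' + [v, q]` is Schwartz and lies in the image of `ad(a)`, `a = diag(α)`: these are the
properties of `q = Q_{b,k}(v)` which allow one to construct `Q_{b,k+1}(v)`. -/
structure IsFluxTerm (α : Fin n → ℂ) (v q : ℝ → CMat n) : Prop where
  differentiable : Differentiable ℝ q
  schwartz_deriv : IsSchwartz (deriv q)
  centralizerPart_eq_zero : ∀ x, centralizerPart α (deriv q x + ⁅v x, q x⁆) = 0

/-- The part of `Q_{b,k+1}(v)` in the image of `ad(a)`, in terms of `q = Q_{b,k}(v)`. -/
noncomputable def fluxOffDiag (α : Fin n → ℂ) (v q : ℝ → CMat n) (x : ℝ) : CMat n :=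
  -adInv α (deriv q x + ⁅v x, q x⁆)

/-- `Q_{b,k+1}(v)` in terms of `q = Q_{b,k}(v)`. -/
noncomputable def fluxNext (α : Fin n → ℂ) (v q : ℝ → CMat n) (x : ℝ) : CMat n :=
  fluxOffDiag α v q x - centralizerPart α (∫ y in Set.Iic x, ⁅v y, fluxOffDiag α v q y⁆)

section FluxNext

variable {q : ℝ → CMat n}

theorem centralizerPart_fluxOffDiag (x : ℝ) : centralizerPart α (fluxOffDiag α v q x) = 0 := by
  rw [fluxOffDiag, ← zero_sub, centralizerPart_sub, centralizerPart_adInv, sub_eq_zero]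
  exact map_zero (centralizerPartCLM α)

theorem isFluxTerm_const (hv0 : ∀ x, centralizerPart α (v x) = 0)
    (hb : Commute b (Matrix.diagonal α)) : IsFluxTerm α v fun _ => b where
  differentiable := differentiable_const b
  schwartz_deriv := ⟨0, by simp only [deriv_const']; rfl⟩
  centralizerPart_eq_zero x := by
    rw [deriv_const, zero_add, centralizerPart_lie_of_commute hb (hv0 x)]

namespace IsFluxTerm

variable (h : IsFluxTerm α v q) (hv : IsSchwartz v)

include h

theorem lie_next (x : ℝ) :
    ⁅fluxNext α v q x, Matrix.diagonal α⁆ = deriv q x + ⁅v x, q x⁆ := by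
  have hcomm := commute_iff_lie_eq.mp <|
    commute_centralizerPart (α := α) (∫ y in Set.Iic x, ⁅v y, fluxOffDiag α v q y⁆)
  rw [fluxNext, Ring.lie_def, sub_mul, mul_sub, sub_sub_sub_comm, ← Ring.lie_def, ← Ring.lie_def,
    hcomm, sub_zero, fluxOffDiag, lie_neg_adInv_diagonal, h.centralizerPart_eq_zero, sub_zero]

include hv

theorem isSchwartz_offDiag : IsSchwartz (fluxOffDiag α v q) := by
  have hq := h.schwartz_deriv.hasTemperateGrowth_of_hasDerivAt fun x =>
    (h.differentiable x).hasDerivAt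
  exact ((h.schwartz_deriv.add (hv.lie hq)).clm_apply (adInvCLM α)).neg

theorem hasDerivAt_next (x : ℝ) : HasDerivAt (fluxNext α v q)
    (deriv (fluxOffDiag α v q) x - centralizerPart α ⁅v x, fluxOffDiag α v q x⁆) x := by
  have hP := h.isSchwartz_offDiag hv
  have hI := (hv.lie hP.hasTemperateGrowth).hasDerivAt_integral_Iic x
  exact (hP.hasDerivAt x).sub ((centralizerPartCLM α).hasFDerivAt.comp_hasDerivAt x hI)

theorem tendsto_next : Tendsto (fluxNext α v q) atBot (𝓝 0) := by
  have hP := h.isSchwartz_offDiag hv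
  have hI := ((centralizerPartCLM α).continuous.tendsto 0).comp
    (tendsto_integral_Iic_zero (μ := volume) (f := fun y => ⁅v y, fluxOffDiag α v q y⁆) tendsto_id)
  rw [map_zero] at hI
  exact sub_zero (0 : CMat n) ▸ hP.tendsto_atBot.sub hI

theorem next (hv0 : ∀ x, centralizerPart α (v x) = 0) : IsFluxTerm α v (fluxNext α v q) where
  differentiable x := (h.hasDerivAt_next hv x).differentiableAt
  schwartz_deriv := by
    have hP := h.isSchwartz_offDiag hv
    rw [funext fun x => (h.hasDerivAt_next hv x).deriv]
    simp only [sub_eq_add_neg]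
    exact hP.deriv.add ((hv.lie hP.hasTemperateGrowth).clm_apply (centralizerPartCLM α)).neg
  centralizerPart_eq_zero x := by
    have hP' : centralizerPart α (deriv (fluxOffDiag α v q) x) = 0 := by
      have hd := (centralizerPartCLM α).hasFDerivAt.comp_hasDerivAt x
        ((h.isSchwartz_offDiag hv).hasDerivAt x)
      exact hd.unique ((hasDerivAt_const x 0).congr_of_eventuallyEq
        (.of_forall centralizerPart_fluxOffDiag))
    have hlie (M T : CMat n) : ⁅v x, M - T⁆ = ⁅v x, M⁆ - ⁅v x, T⁆ := by
      simp only [Ring.lie_def]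
      noncomm_ring
    rw [(h.hasDerivAt_next hv x).deriv, fluxNext, hlie, centralizerPart_add, centralizerPart_sub,
      centralizerPart_sub, hP', centralizerPart_of_commute (commute_centralizerPart _),
      centralizerPart_lie_of_commute (commute_centralizerPart _) (hv0 x)]
    abel

end IsFluxTerm

end FluxNext

section FluxQ

variable (hv : IsSchwartz v) (hv0 : ∀ x, centralizerPart α (v x) = 0)
  (hb : Commute b (Matrix.diagonal α))

include hv

theorem fluxQ_succ {k : ℕ} (h : IsFluxTerm α v (fluxQ α b v k)) :
    fluxQ α b v (k + 1) = fluxNext α v (fluxQ α b v k) := by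
  have hP : (fun y => -adInv α (matDeriv (fluxQ α b v k) y + ⁅v y, fluxQ α b v k y⁆)) =
      fluxOffDiag α v (fluxQ α b v k) :=
    funext fun y => by rw [fluxOffDiag, matDeriv_eq (h.differentiable y).hasDerivAt]
  have hI := (hv.lie (h.isSchwartz_offDiag hv).hasTemperateGrowth)
  funext x
  have hcomm := (centralizerPartCLM α).integral_comp_comm
    (hI.integrable.integrableOn (s := Set.Iic x))
  have hentry := of_integral_entry
    ((hI.clm_apply (centralizerPartCLM α)).integrable.integrableOn (s := Set.Iic x))
  simp only [fluxQ, fluxNext]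
  rw [← hP] at hentry hcomm ⊢
  exact congrArg _ (hentry.trans hcomm)

include hv0 hb

theorem isFluxTerm_fluxQ (k : ℕ) : IsFluxTerm α v (fluxQ α b v k) := by
  induction k with
  | zero => exact isFluxTerm_const hv0 hb
  | succ k ih => exact fluxQ_succ hv ih ▸ ih.next hv hv0

theorem isFluxSequence_fluxQ : IsFluxSequence (Matrix.diagonal α) b v (fluxQ α b v) where
  zero := rfl
  hasDerivAt k x := by
    have h := isFluxTerm_fluxQ hv hv0 hb k
    rw [fluxQ_succ hv h, h.lie_next, add_sub_cancel_right]
    exact (h.differentiable x).hasDerivAt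
  tendsto k := by
    have h := isFluxTerm_fluxQ hv hv0 hb k
    exact fluxQ_succ hv h ▸ h.tendsto_next hv

end FluxQ

end FluxSequence

end MatrixFlux

section ScalarDecay

open Filter Topology

theorem exists_monotoneOn_of_deriv_nonneg {f f' : ℝ → ℝ}
    (h : ∀ᶠ x in atTop, HasDerivAt f (f' x) x ∧ 0 ≤ f' x) :
    ∃ X, MonotoneOn f (Set.Ici X) := by
  obtain ⟨X, hX⟩ := eventually_atTop.mp h
  refine ⟨X, monotoneOn_of_hasDerivWithinAt_nonneg (f' := f') (convex_Ici X)
    (fun x hx => (hX x hx).1.continuousAt.continuousWithinAt) (fun x hx => ?_) fun x hx => ?_⟩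
  · exact (hX x (interior_subset hx)).1.hasDerivWithinAt
  · exact (hX x (interior_subset hx)).2

/-- `f` is bounded above, near `+∞`, by the derivative of a function which is bounded above. For
nonnegative `f` this is a way to say that `f` is integrable near `+∞`. -/
def HasBoundedPotential (f : ℝ → ℝ) : Prop :=
  ∃ Φ Φ' : ℝ → ℝ, (∀ᶠ x in atTop, HasDerivAt Φ (Φ' x) x ∧ f x ≤ Φ' x) ∧
    IsBoundedUnder (· ≤ ·) atTop Φ

namespace HasBoundedPotential

variable {f g : ℝ → ℝ}

theorem mono (hf : HasBoundedPotential f) (hgf : ∀ᶠ x in atTop, g x ≤ f x) :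
    HasBoundedPotential g := by
  obtain ⟨Φ, Φ', hΦ, hb⟩ := hf
  refine ⟨Φ, Φ', ?_, hb⟩
  filter_upwards [hΦ, hgf] with x hx hgx
  exact ⟨hx.1, hgx.trans hx.2⟩

theorem add (hf : HasBoundedPotential f) (hg : HasBoundedPotential g) :
    HasBoundedPotential fun x => f x + g x := by
  obtain ⟨Φ, Φ', hΦ, hΦb⟩ := hf
  obtain ⟨Ψ, Ψ', hΨ, hΨb⟩ := hg
  refine ⟨Φ + Ψ, Φ' + Ψ', ?_, isBoundedUnder_le_add hΦb hΨb⟩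
  filter_upwards [hΦ, hΨ] with x hx hy
  exact ⟨hx.1.add hy.1, add_le_add hx.2 hy.2⟩

theorem const_mul {c : ℝ} (hc : 0 ≤ c) (hf : HasBoundedPotential f) :
    HasBoundedPotential fun x => c * f x := by
  obtain ⟨Φ, Φ', hΦ, C, hC⟩ := hf
  refine ⟨fun x => c * Φ x, fun x => c * Φ' x, ?_, isBoundedUnder_of_eventually_le (a := c * C) ?_⟩
  · filter_upwards [hΦ] with x hx
    exact ⟨hx.1.const_mul c, mul_le_mul_of_nonneg_left hx.2 hc⟩
  · filter_upwards [eventually_map.mp hC] with x hx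
    exact mul_le_mul_of_nonneg_left hx hc

theorem of_sq_mul_bounded (hf : IsBoundedUnder (· ≤ ·) atTop fun x => x ^ 2 * f x) :
    HasBoundedPotential f := by
  obtain ⟨C, hC⟩ := hf
  refine ⟨fun x => -(|C| * x⁻¹), fun x => |C| * (x ^ 2)⁻¹, ?_,
    isBoundedUnder_of_eventually_le (a := 0) ?_⟩
  · filter_upwards [eventually_map.mp hC, eventually_gt_atTop 0] with x hx hx0
    refine ⟨((hasDerivAt_inv hx0.ne').const_mul |C|).neg.congr_deriv (by ring), ?_⟩
    rw [← div_eq_mul_inv, le_div_iff₀' (by positivity)]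
    exact hx.trans (le_abs_self C)
  · filter_upwards [eventually_gt_atTop 0] with x hx
    have := mul_nonneg (abs_nonneg C) (inv_nonneg.mpr hx.le)
    simpa using this

theorem bounded_of_deriv_le (hf : HasBoundedPotential f) {y y' : ℝ → ℝ}
    (hy : ∀ᶠ x in atTop, HasDerivAt y (y' x) x ∧ y' x ≤ f x) :
    IsBoundedUnder (· ≤ ·) atTop y := by
  obtain ⟨Φ, Φ', hΦ, C, hC⟩ := hf
  obtain ⟨X, hX⟩ := exists_monotoneOn_of_deriv_nonneg (f := Φ - y) (f' := Φ' - y') <| by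
    filter_upwards [hΦ, hy] with x hx hyx
    exact ⟨hx.1.sub hyx.1, sub_nonneg.mpr (hyx.2.trans hx.2)⟩
  refine isBoundedUnder_of_eventually_le (a := C - (Φ X - y X)) ?_
  filter_upwards [eventually_map.mp hC, eventually_ge_atTop X] with x hx hXx
  have := hX Set.self_mem_Ici hXx hXx
  simp only [Pi.sub_apply] at this
  linarith

theorem frequently_lt (hf : HasBoundedPotential f) {ε : ℝ} (hε : 0 < ε) :
    ∃ᶠ x in atTop, f x < ε := by
  intro h
  obtain ⟨C, hC⟩ := hf.bounded_of_deriv_le (y := fun x => x * ε) (y' := fun _ => ε) <| by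
    filter_upwards [h] with x hx
    exact ⟨hasDerivAt_mul_const ε, not_lt.mp hx⟩
  obtain ⟨x, hx, hx'⟩ := ((eventually_map.mp hC).and (eventually_gt_atTop (C / ε))).exists
  exact absurd hx (not_le.mpr ((div_lt_iff₀ hε).mp hx'))

end HasBoundedPotential

/-- A bounded function `G` of one real variable which increases, up to a rapidly decreasing error
`w`, at least at the rate `c N`, and which is as close as `K N` to a finite set of critical
values. -/
structure IsGradientLike (c K : ℝ) (S : Set ℝ) (G N w : ℝ → ℝ) : Prop where
  rate_pos : 0 < c
  finite : S.Finite
  bounded : IsBoundedUnder (· ≤ ·) atTop G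
  nonneg : ∀ x, 0 ≤ N x
  exists_near : ∀ x, ∃ s ∈ S, |G x - s| ≤ K * N x
  exists_deriv : ∀ x, ∃ G', HasDerivAt G G' x ∧ c * N x ≤ G' + w x
  rapid : ∀ k : ℕ, IsBoundedUnder (· ≤ ·) atTop fun x => x ^ k * w x

namespace IsGradientLike

variable {c K : ℝ} {S : Set ℝ} {G N w : ℝ → ℝ} (h : IsGradientLike c K S G N w)

include h

theorem hasDerivAt (x : ℝ) : HasDerivAt G (deriv G x) x := by
  obtain ⟨G', hG', -⟩ := h.exists_deriv x
  exact hG'.differentiableAt.hasDerivAt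

theorem rate_le (x : ℝ) : c * N x ≤ deriv G x + w x := by
  obtain ⟨G', hG', hle⟩ := h.exists_deriv x
  rwa [hG'.deriv]

theorem exists_monotoneOn_sub_inv_pow (k : ℕ) :
    ∃ C X, MonotoneOn (fun x => G x - C * (x ^ (k + 1))⁻¹) (Set.Ici X) := by
  obtain ⟨C, hC⟩ := h.rapid (k + 2)
  refine ⟨C / (k + 1), exists_monotoneOn_of_deriv_nonneg
    (f' := fun x => deriv G x + C * (x ^ (k + 2))⁻¹) ?_⟩
  filter_upwards [eventually_map.mp hC, eventually_gt_atTop 0] with x hx hx0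
  constructor
  · refine ((h.hasDerivAt x).sub (((hasDerivAt_pow (k + 1) x).inv
      (pow_ne_zero _ hx0.ne')).const_mul (C / (k + 1)))).congr_deriv ?_
    push_cast
    field_simp
    ring
  · have hw : w x ≤ C * (x ^ (k + 2))⁻¹ := by
      rwa [← div_eq_mul_inv, le_div_iff₀' (by positivity)]
    linarith [h.rate_le x, mul_nonneg h.rate_pos.le (h.nonneg x)]

theorem hasBoundedPotential : HasBoundedPotential N := by
  have hG : HasBoundedPotential (deriv G) :=
    ⟨G, deriv G, .of_forall fun x => ⟨h.hasDerivAt x, le_rfl⟩, h.bounded⟩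
  refine ((hG.add (.of_sq_mul_bounded (h.rapid 2))).const_mul
    (inv_nonneg.mpr h.rate_pos.le)).mono (.of_forall fun x => ?_)
  rw [le_inv_mul_iff₀ h.rate_pos]
  exact h.rate_le x

theorem exists_tendsto : ∃ L, Tendsto G atTop (𝓝 L) := by
  obtain ⟨C, X, hX⟩ := h.exists_monotoneOn_sub_inv_pow 0
  have hinv : Tendsto (fun x : ℝ => C * (x ^ (0 + 1))⁻¹) atTop (𝓝 0) := by
    simpa using tendsto_inv_atTop_zero.const_mul C
  have hmono : Monotone fun x => G (max x X) - C * (max x X ^ (0 + 1))⁻¹ := fun x y hxy =>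
    hX (le_max_right x X) (le_max_right y X) (max_le_max_right X hxy)
  have heq : (fun x => G (max x X) - C * (max x X ^ (0 + 1))⁻¹) =ᶠ[atTop]
      fun x => G x - C * (x ^ (0 + 1))⁻¹ := by
    filter_upwards [eventually_ge_atTop X] with x hx
    rw [max_eq_left hx]
  rcases tendsto_atTop_of_monotone hmono with htop | ⟨L, hL⟩
  · have hG := (htop.congr' heq).atTop_add hinv
    simp only [sub_add_cancel] at hG
    exact absurd h.bounded (not_isBoundedUnder_of_tendsto_atTop hG)
  · exact ⟨L, by simpa using (hL.congr' heq).add hinv⟩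

variable {L : ℝ} (hL : Tendsto G atTop (𝓝 L))

include hL

theorem eventually_abs_sub_le : ∀ᶠ x in atTop, |G x - L| ≤ K * N x := by
  have hLS : L ∈ S := h.finite.isClosed.closure_subset <| Metric.mem_closure_iff.mpr fun ε hε => by
    obtain ⟨x, hx, hGx⟩ := ((h.hasBoundedPotential.const_mul (abs_nonneg K)).frequently_lt
      (half_pos hε)).and_eventually (Metric.tendsto_nhds.mp hL _ (half_pos hε)) |>.exists
    obtain ⟨s, hs, hGs⟩ := h.exists_near x
    refine ⟨s, hs, (dist_triangle_left L s (G x)).trans_lt ?_⟩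
    have := mul_le_mul_of_nonneg_right (le_abs_self K) (h.nonneg x)
    rw [Real.dist_eq (G x) s]
    linarith
  have hclosest : ∀ᶠ y in 𝓝 L, ∀ s ∈ S, |y - L| ≤ |y - s| :=
    h.finite.eventually_all.mpr fun s _ => by
      rcases eq_or_ne s L with rfl | hsL
      · exact .of_forall fun y => le_rfl
      · have hlt : |L - L| < |L - s| := by simpa [sub_eq_zero] using hsL.symm
        exact ((by fun_prop : Continuous fun y => |y - L|).tendsto L).eventually_lt
          ((by fun_prop : Continuous fun y => |y - s|).tendsto L) hlt |>.mono fun _ => le_of_lt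
  filter_upwards [hL.eventually hclosest] with x hx
  obtain ⟨s, hs, hGs⟩ := h.exists_near x
  exact (hx s hs).trans hGs

theorem bounded_pow_mul_sub (k : ℕ) :
    IsBoundedUnder (· ≤ ·) atTop fun x => x ^ (k + 1) * (G x - L) := by
  obtain ⟨C, X, hX⟩ := h.exists_monotoneOn_sub_inv_pow k
  have hlim : Tendsto (fun x => G x - C * (x ^ (k + 1))⁻¹) atTop (𝓝 L) := by
    simpa using hL.sub ((tendsto_pow_atTop k.succ_ne_zero).inv_tendsto_atTop.const_mul C)
  refine isBoundedUnder_of_eventually_le (a := C) ?_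
  filter_upwards [eventually_ge_atTop X, eventually_gt_atTop 0] with x hx hx0
  have hle : G x - C * (x ^ (k + 1))⁻¹ ≤ L := ge_of_tendsto hlim <| by
    filter_upwards [eventually_ge_atTop x] with y hxy
    exact hX hx (hx.trans hxy) hxy
  rw [← le_div_iff₀' (by positivity), div_eq_mul_inv]
  linarith

theorem hasBoundedPotential_pow_mul (k : ℕ) : HasBoundedPotential fun x => x ^ k * N x := by
  induction k with
  | zero => simpa using h.hasBoundedPotential
  | succ k ih =>
    have hexact : HasBoundedPotential fun x =>
        (k + 1 : ℕ) * x ^ k * (G x - L) + x ^ (k + 1) * deriv G x :=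
      ⟨_, _, .of_forall fun x =>
        ⟨(hasDerivAt_pow (k + 1) x).mul ((h.hasDerivAt x).sub_const L), le_rfl⟩,
        h.bounded_pow_mul_sub hL k⟩
    have hrapid : HasBoundedPotential fun x => x ^ (k + 1) * w x :=
      .of_sq_mul_bounded <| by simpa only [← mul_assoc, ← pow_add] using h.rapid (2 + (k + 1))
    have hnear := ih.const_mul (mul_nonneg (Nat.cast_nonneg (k + 1)) (abs_nonneg K))
    refine (((hexact.add hrapid).add hnear).const_mul (inv_nonneg.mpr h.rate_pos.le)).mono ?_
    filter_upwards [h.eventually_abs_sub_le hL, eventually_gt_atTop 0] with x hx hx0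
    rw [le_inv_mul_iff₀ h.rate_pos]
    have hGL : -(|K| * N x) ≤ G x - L :=
      (neg_le_neg (hx.trans (mul_le_mul_of_nonneg_right (le_abs_self K) (h.nonneg x)))).trans
        (neg_abs_le _)
    have hrate := mul_le_mul_of_nonneg_left (h.rate_le x) (pow_nonneg hx0.le (k + 1))
    have hlow := mul_le_mul_of_nonneg_left hGL
      (mul_nonneg (Nat.cast_nonneg (k + 1)) (pow_nonneg hx0.le k))
    linarith

omit hL in
theorem bounded_pow_mul {B : ℝ} (hB : ∀ x, N x ≤ B) {N' : ℝ → ℝ}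
    (hN : ∀ x, HasDerivAt N (N' x) x) (hN' : ∀ x, |N' x| ≤ B) (k : ℕ) :
    IsBoundedUnder (· ≤ ·) atTop fun x => x ^ k * N x := by
  obtain ⟨L, hL⟩ := h.exists_tendsto
  have hB0 : 0 ≤ B := (h.nonneg 0).trans (hB 0)
  obtain ⟨C, hC⟩ := ((h.hasBoundedPotential_pow_mul hL (2 * k + 1)).const_mul
      (by positivity : 0 ≤ (2 * k + 1 : ℕ) * B + 2 * B)).bounded_of_deriv_le
    (y := fun x => x ^ (2 * k + 1) * N x ^ 2)
    (y' := fun x => (2 * k + 1 : ℕ) * x ^ (2 * k) * N x ^ 2 +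
      x ^ (2 * k + 1) * (2 * N x * N' x)) <| by
    filter_upwards [eventually_ge_atTop 1] with x hx
    refine ⟨((hasDerivAt_pow (2 * k + 1) x).mul ((hN x).pow 2)).congr_deriv (by simp), ?_⟩
    have hN2 : N x ^ 2 ≤ B * N x := by
      rw [sq]
      exact mul_le_mul_of_nonneg_right (hB x) (h.nonneg x)
    have hNN' : N x * N' x ≤ N x * B :=
      mul_le_mul_of_nonneg_left ((le_abs_self _).trans (hN' x)) (h.nonneg x)
    have hpow : x ^ (2 * k) ≤ x ^ (2 * k + 1) := pow_le_pow_right₀ hx (Nat.le_succ _)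
    calc _ ≤ (2 * k + 1 : ℕ) * x ^ (2 * k + 1) * (B * N x) +
            x ^ (2 * k + 1) * (2 * (N x * B)) := by
          rw [mul_assoc 2]
          gcongr
      _ = _ := by ring
  refine isBoundedUnder_of_eventually_le (a := 1 + C) ?_
  filter_upwards [eventually_map.mp hC, eventually_ge_atTop 1] with x hx hx1
  have hsq : (x ^ k * N x) ^ 2 ≤ x ^ (2 * k + 1) * N x ^ 2 := by
    rw [mul_pow, ← pow_mul, mul_comm k]
    gcongr
    exact Nat.le_succ _
  nlinarith [sq_nonneg (x ^ k * N x - 1)]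

end IsGradientLike

end ScalarDecay

section NearCritical

open scoped ComplexOrder

variable {ι : Type*} [Fintype ι]

theorem trace_mul_conjTranspose_self {κ : Type*} [Fintype κ] (B : Matrix ι κ ℂ) :
    (B * B.conjTranspose).trace = ((∑ i, ∑ k, ‖B i k‖ ^ 2 : ℝ) : ℂ) := by
  simp [Matrix.trace, Matrix.mul_apply, Complex.mul_conj']

theorem exists_nat_near_of_sq_le {a : ℝ} (h : 0 ≤ a - a ^ 2) :
    ∃ m : ℕ, m ≤ 1 ∧ |a - m| ≤ 2 * (a - a ^ 2) := by
  have : 0 ≤ a := by nlinarith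
  have : a ≤ 1 := by nlinarith
  rcases le_total a (1 / 2) with ha | ha
  · exact ⟨0, zero_le_one, by rw [abs_le]; constructor <;> push_cast <;> nlinarith⟩
  · exact ⟨1, le_rfl, by rw [abs_le]; constructor <;> push_cast <;> nlinarith⟩

theorem exists_nat_near_trace {A : Matrix ι ι ℂ} (hA : A.IsHermitian)
    (h : (A - A * A).PosSemidef) :
    ∃ m : ℕ, m ≤ Fintype.card ι ∧ ‖A.trace - m‖ ≤ 2 * (A - A * A).trace.re := by
  classical
  let U := hA.eigenvectorUnitary
  let μ := hA.eigenvalues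
  have hdiag : A - A * A = (U : Matrix ι ι ℂ) *
      Matrix.diagonal (fun i => ((μ i - μ i ^ 2 : ℝ) : ℂ)) * star (U : Matrix ι ι ℂ) := by
    rw [← Unitary.conjStarAlgAut_apply (S := ℂ)]
    nth_rewrite 1 2 3 [hA.spectral_theorem]
    rw [← map_mul, ← map_sub, Matrix.diagonal_mul_diagonal, Matrix.diagonal_sub]
    simp [sq, U, μ]
  have hμ : ∀ i, 0 ≤ μ i - μ i ^ 2 := by
    have hU : IsUnit (U : Matrix ι ι ℂ) := Unitary.isUnit_coe
    rw [hdiag, Matrix.IsUnit.posSemidef_star_right_conjugate_iff hU,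
      Matrix.posSemidef_diagonal_iff] at h
    exact fun i => Complex.zero_le_real.mp (h i)
  have htrace : (A - A * A).trace.re = ∑ i, (μ i - μ i ^ 2) := by
    rw [hdiag, Matrix.trace_mul_cycle, Unitary.coe_star_mul_self, one_mul, Matrix.trace_diagonal,
      ← Complex.ofReal_sum, Complex.ofReal_re]
  choose m hm1 hm using fun i => exists_nat_near_of_sq_le (hμ i)
  refine ⟨∑ i, m i, (Finset.sum_le_sum fun i _ => hm1 i).trans_eq (by simp), ?_⟩
  rw [htrace, Finset.mul_sum, hA.trace_eq_sum_eigenvalues, Nat.cast_sum, ← Finset.sum_sub_distrib]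
  refine (norm_sum_le _ _).trans (Finset.sum_le_sum fun i _ => ?_)
  have hi := hm i
  rw [← Real.norm_eq_abs, ← Complex.norm_real, Complex.ofReal_sub] at hi
  exact hi

theorem exists_nat_near_trace_toBlock {ρ : Matrix ι ι ℂ} (hρ : IsStarProjection ρ)
    (p : ι → Prop) [DecidablePred p] :
    ∃ m : ℕ, m ≤ Fintype.card ι ∧ ‖(ρ.toBlock p p).trace - m‖ ≤
      2 * ∑ i : {i // p i}, ∑ k : {k // ¬p k}, ‖ρ i k‖ ^ 2 := by
  let A := ρ.toBlock p p
  let B := ρ.toBlock p fun i => ¬p i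
  have hherm : ρ.IsHermitian := hρ.isSelfAdjoint
  have hA : A.IsHermitian := hherm.submatrix _
  have hAB : A - A * A = B * B.conjTranspose := by
    have hB : B.conjTranspose = ρ.toBlock (fun i => ¬p i) p := by
      rw [← hherm.eq]
      rfl
    have hblock := Matrix.toBlock_mul_eq_add ρ ρ (p := p) (q := p) (r := p)
    rw [hρ.isIdempotentElem.eq] at hblock
    rw [hB, sub_eq_iff_eq_add']
    exact hblock
  obtain ⟨m, hm, hle⟩ := exists_nat_near_trace hA
    (hAB ▸ Matrix.posSemidef_self_mul_conjTranspose B)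
  refine ⟨m, hm.trans (Fintype.card_subtype_le p), ?_⟩
  rwa [hAB, trace_mul_conjTranspose_self, Complex.ofReal_re] at hle

variable {n : ℕ}

/-- The square of the Hilbert–Schmidt norm. -/
noncomputable def hsNormSq (X : CMat n) : ℝ :=
  ∑ i, ∑ k, ‖X i k‖ ^ 2

theorem hsNormSq_nonneg (X : CMat n) : 0 ≤ hsNormSq X := by
  unfold hsNormSq
  positivity

theorem sum_block_le_hsNormSq (α : Fin n → ℂ) : ∃ M, ∀ (ρ : CMat n) (c : ℂ),
    ∑ i : {i // α i = c}, ∑ k : {k // ¬α k = c}, ‖ρ i k‖ ^ 2 ≤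
      M * hsNormSq ⁅ρ, Matrix.diagonal α⁆ := by
  have hsub {p : Fin n → Prop} [DecidablePred p] {f : Fin n → ℝ} (hf : ∀ i, 0 ≤ f i) :
      ∑ i : {i // p i}, f i ≤ ∑ i, f i := by
    rw [← Finset.sum_subtype (Finset.univ.filter p) (by simp)]
    exact Finset.sum_le_univ_sum_of_nonneg hf
  obtain ⟨M, hM⟩ := (Set.finite_range fun p : Fin n × Fin n => (‖α p.2 - α p.1‖ ^ 2)⁻¹).bddAbove
  have hM' : ∀ i k, (‖α k - α i‖ ^ 2)⁻¹ ≤ M := fun i k => hM (Set.mem_range_self (i, k))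
  refine ⟨M, fun ρ c => ?_⟩
  have hentry : ∀ (i : {i // α i = c}) (k : {k // ¬α k = c}),
      ‖ρ i k‖ ^ 2 ≤ M * ‖⁅ρ, Matrix.diagonal α⁆ i k‖ ^ 2 := fun i k => by
    have hik : α k - α i ≠ 0 := sub_ne_zero.mpr fun h => k.2 (h.trans i.2)
    rw [lie_diagonal_apply, norm_mul, mul_pow, ← mul_assoc]
    refine le_mul_of_one_le_left (sq_nonneg _) ?_
    rw [← inv_mul_cancel₀ (pow_ne_zero 2 (norm_ne_zero_iff.mpr hik))]
    exact mul_le_mul_of_nonneg_right (hM' i k) (sq_nonneg _)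
  have hnonneg : ∀ i k, 0 ≤ M * ‖⁅ρ, Matrix.diagonal α⁆ i k‖ ^ 2 := fun i k =>
    mul_nonneg ((inv_nonneg.mpr (sq_nonneg _)).trans (hM' i k)) (sq_nonneg _)
  simp only [hsNormSq, Finset.mul_sum]
  calc _ ≤ ∑ i : {i // α i = c}, ∑ k, M * ‖⁅ρ, Matrix.diagonal α⁆ i k‖ ^ 2 :=
        Finset.sum_le_sum fun i _ =>
          (Finset.sum_le_sum fun k _ => hentry i k).trans (hsub (hnonneg i))
    _ ≤ _ := hsub fun i => Finset.sum_nonneg fun k _ => hnonneg i k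

theorem trace_diagonal_mul (α : Fin n → ℂ) (ρ : CMat n) :
    (Matrix.diagonal α * ρ).trace =
      ∑ c : Finset.univ.image α, c * (ρ.toBlock (α · = c) (α · = c)).trace := by
  have hblock : ∀ c : ℂ, c * (ρ.toBlock (α · = c) (α · = c)).trace =
      ∑ i with α i = c, α i * ρ i i := fun c => by
    rw [Matrix.trace, Finset.mul_sum, Finset.sum_subtype (p := (α · = c)) _ (by simp)]
    exact Finset.sum_congr rfl fun i _ => by rw [i.2]; rfl
  simp only [hblock]
  rw [Finset.sum_coe_sort (Finset.univ.image α) fun c => ∑ i with α i = c, α i * ρ i i,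
    Finset.sum_fiberwise_of_maps_to fun i hi => Finset.mem_image_of_mem α hi]
  simp [Matrix.trace, Matrix.diagonal_mul]

theorem exists_finite_near_trace (α : Fin n → ℂ) : ∃ (S : Set ℂ) (K : ℝ), S.Finite ∧
    ∀ ρ : CMat n, IsStarProjection ρ → ∃ s ∈ S,
      ‖(Matrix.diagonal α * ρ).trace - s‖ ≤ K * hsNormSq ⁅ρ, Matrix.diagonal α⁆ := by
  obtain ⟨M, hM⟩ := sum_block_le_hsNormSq α
  refine ⟨Set.range fun m : Finset.univ.image α → Fin (n + 1) => ∑ c, c * (m c : ℂ),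
    ∑ c : Finset.univ.image α, ‖(c : ℂ)‖ * (2 * M), Set.finite_range _, fun ρ hρ => ?_⟩
  choose m hm hnear using fun c : Finset.univ.image α =>
    exists_nat_near_trace_toBlock hρ (α · = (c : ℂ))
  refine ⟨_, ⟨fun c => ⟨m c, by simpa [Nat.lt_succ_iff] using hm c⟩, rfl⟩, ?_⟩
  rw [trace_diagonal_mul, ← Finset.sum_sub_distrib, Finset.sum_mul]
  refine (norm_sum_le _ _).trans (Finset.sum_le_sum fun c _ => ?_)
  rw [← mul_sub, norm_mul, mul_assoc, mul_assoc]
  gcongr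
  exact (hnear c).trans (mul_le_mul_of_nonneg_left (hM ρ c) zero_le_two)

end NearCritical

section Decay

variable {V V' : Type*} [NormedAddCommGroup V] [NormedSpace ℝ V] [NormedAddCommGroup V']
  [NormedSpace ℝ V']

/-- `f` is `m` times differentiable, and the products of `|x| ^ k` with `f` and with its first `m`
derivatives are bounded. -/
def HasDecay (k : ℕ) : ℕ → (ℝ → V) → Prop
  | 0, f => ∃ C, ∀ x, |x| ^ k * ‖f x‖ ≤ C
  | m + 1, f => (∃ C, ∀ x, |x| ^ k * ‖f x‖ ≤ C) ∧
      ∃ f', (∀ x, HasDerivAt f (f' x) x) ∧ HasDecay k m f'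

namespace HasDecay

variable {k l m : ℕ} {f g : ℝ → V}

theorem zero_order (h : HasDecay k m f) : HasDecay k 0 f := by
  cases m with
  | zero => exact h
  | succ m => exact h.1

theorem exists_bound (h : HasDecay 0 m f) : ∃ C, ∀ x, ‖f x‖ ≤ C := by
  obtain ⟨C, hC⟩ := h.zero_order
  exact ⟨C, fun x => by simpa using hC x⟩

theorem of_succ (h : HasDecay k (m + 1) f) : HasDecay k m f := by
  induction m generalizing f with
  | zero => exact h.1
  | succ m ih =>
    obtain ⟨hf, f', hf', h'⟩ := h
    exact ⟨hf, f', hf', ih h'⟩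

theorem const (m : ℕ) (c : V) : HasDecay 0 m fun _ => c := by
  induction m generalizing c with
  | zero => exact ⟨‖c‖, fun x => by simp⟩
  | succ m ih => exact ⟨(ih c).zero_order, _, fun x => hasDerivAt_const x c, ih 0⟩

theorem clm_apply (L : V →L[ℝ] V') (hf : HasDecay k m f) : HasDecay k m fun x => L (f x) := by
  induction m generalizing f with
  | zero =>
    obtain ⟨C, hC⟩ := hf
    refine ⟨‖L‖ * C, fun x => ?_⟩
    calc |x| ^ k * ‖L (f x)‖ ≤ |x| ^ k * (‖L‖ * ‖f x‖) := by gcongr; exact L.le_opNorm _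
      _ = ‖L‖ * (|x| ^ k * ‖f x‖) := by ring
      _ ≤ ‖L‖ * C := by gcongr; exact hC x
  | succ m ih =>
    obtain ⟨-, f', hf', h'⟩ := id hf
    exact ⟨(ih hf.of_succ).zero_order, _, fun x => L.hasFDerivAt.comp_hasDerivAt x (hf' x), ih h'⟩

theorem add (hf : HasDecay k m f) (hg : HasDecay k m g) : HasDecay k m fun x => f x + g x := by
  induction m generalizing f g with
  | zero =>
    obtain ⟨C, hC⟩ := hf
    obtain ⟨D, hD⟩ := hg
    refine ⟨C + D, fun x => ?_⟩
    calc |x| ^ k * ‖f x + g x‖ ≤ |x| ^ k * (‖f x‖ + ‖g x‖) := by gcongr; exact norm_add_le _ _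
      _ ≤ C + D := by rw [mul_add]; exact add_le_add (hC x) (hD x)
  | succ m ih =>
    obtain ⟨-, f', hf', hfm⟩ := id hf
    obtain ⟨-, g', hg', hgm⟩ := id hg
    exact ⟨(ih hf.of_succ hg.of_succ).zero_order, _, fun x => (hf' x).add (hg' x), ih hfm hgm⟩

theorem mul {A : Type*} [NormedRing A] [NormedAlgebra ℝ A] {f g : ℝ → A} (hf : HasDecay k m f)
    (hg : HasDecay l m g) : HasDecay (k + l) m fun x => f x * g x := by
  induction m generalizing f g with
  | zero =>
    obtain ⟨C, hC⟩ := hf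
    obtain ⟨D, hD⟩ := hg
    refine ⟨C * D, fun x => ?_⟩
    calc |x| ^ (k + l) * ‖f x * g x‖ ≤ |x| ^ (k + l) * (‖f x‖ * ‖g x‖) := by
          gcongr; exact norm_mul_le _ _
      _ = (|x| ^ k * ‖f x‖) * (|x| ^ l * ‖g x‖) := by ring
      _ ≤ C * D := mul_le_mul (hC x) (hD x) (by positivity)
          ((by positivity : 0 ≤ |x| ^ k * ‖f x‖).trans (hC x))
  | succ m ih =>
    obtain ⟨-, f', hf', hfm⟩ := id hf
    obtain ⟨-, g', hg', hgm⟩ := id hg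
    exact ⟨(ih hf.of_succ hg.of_succ).zero_order, _, fun x => (hf' x).mul (hg' x),
      (ih hfm hg.of_succ).add (ih hf.of_succ hgm)⟩

theorem lie {A : Type*} [NormedRing A] [NormedAlgebra ℝ A] {f g : ℝ → A} (hf : HasDecay k m f)
    (hg : HasDecay l m g) : HasDecay (k + l) m fun x => ⁅f x, g x⁆ := by
  have hgf := (hg.mul hf).clm_apply (-ContinuousLinearMap.id ℝ A)
  rw [add_comm l k] at hgf
  simpa [Ring.lie_def, sub_eq_add_neg] using (hf.mul hg).add hgf

theorem dressFactor {A : Type*} [NormedRing A] [NormedAlgebra ℂ A] {f : ℝ → A}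
    (hf : HasDecay 0 m f) (z : ℂ) : HasDecay 0 m fun x => dressFactor z (f x) :=
  (const m (z • (1 : A))).add
    (hf.clm_apply (((conj z - z) • ContinuousLinearMap.id ℂ A).restrictScalars ℝ))

theorem iteratedDeriv (hf : HasDecay k (l + m) f) : HasDecay k l (iteratedDeriv m f) := by
  induction m generalizing f with
  | zero => rwa [iteratedDeriv_zero]
  | succ m ih =>
    obtain ⟨-, f', hf', h'⟩ := hf
    rw [iteratedDeriv_succ', funext fun x => (hf' x).deriv]
    exact ih h'

end HasDecay

theorem IsSchwartz.hasDecay {f : ℝ → V} (hf : IsSchwartz f) (k m : ℕ) : HasDecay k m f := by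
  induction m generalizing f with
  | zero =>
    obtain ⟨F, rfl⟩ := hf
    obtain ⟨C, -, hC⟩ := F.decay k 0
    exact ⟨C, fun x => by simpa using hC x⟩
  | succ m ih => exact ⟨ih hf |>.zero_order, _, hf.hasDerivAt, ih hf.deriv⟩

theorem isSchwartz_of_hasDecay {f : ℝ → V} (hf : ∀ k m, HasDecay k m f) : IsSchwartz f := by
  have hdiff : ContDiff ℝ ∞ f := contDiff_of_differentiable_iteratedDeriv fun m _ => by
    obtain ⟨-, f', hf', -⟩ := HasDecay.iteratedDeriv (hf 0 (1 + m))
    exact fun x => (hf' x).differentiableAt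
  refine ⟨⟨f, hdiff, fun k m => ?_⟩, rfl⟩
  simp only [norm_iteratedFDeriv_eq_norm_iteratedDeriv]
  exact HasDecay.iteratedDeriv (l := 0) (hf k (0 + m))

end Decay

section ProjectionFlow

open Filter Topology
open scoped Matrix.Norms.L2Operator

/-- `ρ` is a path of projections solving the `x`-equation of the projection system with spectral
value `z`, potential `v` and diagonal part `a`. -/
structure IsProjectionFlow {A : Type*} [CStarAlgebra A] (z : ℂ) (a : A) (v ρ : ℝ → A) : Prop where
  isStarProjection : ∀ x, IsStarProjection (ρ x)
  hasDerivAt : ∀ x, HasDerivAt ρ (⁅ρ x, v x⁆ + ⁅ρ x, a⁆ * dressFactor z (ρ x)) x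

theorem IsSchwartz.hasDecay_lie_add {A : Type*} [NormedRing A] [NormedAlgebra ℂ A] {a : A}
    {v ρ : ℝ → A} (hv : IsSchwartz v) {k m : ℕ} (hρ : HasDecay 0 m ρ)
    (hK : HasDecay k m fun x => ⁅ρ x, a⁆) (z : ℂ) :
    HasDecay k m fun x => ⁅ρ x, v x⁆ + ⁅ρ x, a⁆ * dressFactor z (ρ x) := by
  have hlie := hρ.lie (hv.hasDecay k m)
  rw [zero_add] at hlie
  exact hlie.add (hK.mul (hρ.dressFactor z))

variable {n : ℕ}

theorem hsNormSq_lie_neg (X Y : CMat n) : hsNormSq ⁅X, -Y⁆ = hsNormSq ⁅X, Y⁆ := by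
  have hneg : ⁅X, -Y⁆ = -⁅X, Y⁆ := by
    simp only [Ring.lie_def, mul_neg, neg_mul, neg_sub_neg, neg_sub]
  simp [hneg, hsNormSq]

theorem hsNormSq_eq_trace (X : CMat n) : hsNormSq X = (X * star X).trace.re := by
  rw [Matrix.star_eq_conjTranspose, trace_mul_conjTranspose_self, Complex.ofReal_re, hsNormSq]

theorem exists_hsNormSq_le (n : ℕ) : ∃ M, 0 ≤ M ∧ ∀ X : CMat n, hsNormSq X ≤ M * ‖X‖ ^ 2 := by
  refine ⟨∑ i, ∑ k, ‖entryCLM (n := n) i k‖ ^ 2, by positivity, fun X => ?_⟩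
  simp only [hsNormSq, Finset.sum_mul, ← mul_pow]
  gcongr with i _ k _
  exact (entryCLM i k).le_opNorm X

theorem exists_norm_sq_le_hsNormSq (n : ℕ) :
    ∃ M, 0 ≤ M ∧ ∀ X : CMat n, ‖X‖ ^ 2 ≤ M * hsNormSq X := by
  refine ⟨(∑ i, ∑ k, ‖singleCLM (n := n) i k‖) ^ 2, by positivity, fun X => ?_⟩
  have hentry : ∀ i k, ‖X i k‖ ≤ √(hsNormSq X) := fun i k => by
    refine Real.le_sqrt_of_sq_le ?_
    calc ‖X i k‖ ^ 2 ≤ ∑ k, ‖X i k‖ ^ 2 :=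
          Finset.single_le_sum (f := fun k => ‖X i k‖ ^ 2) (fun _ _ => sq_nonneg _)
            (Finset.mem_univ k)
      _ ≤ hsNormSq X :=
          Finset.single_le_sum (f := fun i => ∑ k, ‖X i k‖ ^ 2)
            (fun _ _ => Finset.sum_nonneg fun _ _ => sq_nonneg _) (Finset.mem_univ i)
  rw [← Real.sq_sqrt (hsNormSq_nonneg X), ← mul_pow]
  gcongr
  conv_lhs => rw [← sum_singleCLM_entryCLM X]
  simp only [Finset.sum_mul]
  refine (norm_sum_le _ _).trans (Finset.sum_le_sum fun i _ => (norm_sum_le _ _).trans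
    (Finset.sum_le_sum fun k _ => ((singleCLM i k).le_opNorm _).trans ?_))
  exact mul_le_mul_of_nonneg_left (hentry i k) (norm_nonneg _)

theorem trace_mul_lie_add (ρ a v : CMat n) (z : ℂ) :
    (a * (⁅ρ, v⁆ + ⁅ρ, a⁆ * dressFactor z ρ)).trace =
      -(⁅ρ, a⁆ * v).trace + (conj z - z) / 2 * (⁅ρ, a⁆ * ⁅ρ, a⁆).trace := by
  have h₁ := Matrix.trace_mul_comm (a * v) ρ
  have h₂ := Matrix.trace_mul_comm (a * ρ) a
  have h₃ := Matrix.trace_mul_comm (a * ρ * a) ρ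
  have h₄ := Matrix.trace_mul_comm (a * a * ρ) ρ
  have h₅ := Matrix.trace_mul_comm (a * ρ * ρ) a
  simp only [dressFactor, Ring.lie_def, mul_add, mul_sub, sub_mul, mul_smul_comm, mul_one,
    Matrix.trace_add, Matrix.trace_sub, Matrix.trace_smul, smul_eq_mul,
    ← mul_assoc] at h₁ h₂ h₃ h₄ h₅ ⊢
  linear_combination -h₁ + z * h₂ + (conj z - z) / 2 * (h₃ - h₄ + h₅)

theorem star_lie_of_skewAdjoint {R : Type*} [Ring R] [StarRing R] {ρ a : R}
    (ha : a ∈ skewAdjoint R) (hρ : star ρ = ρ) : star ⁅ρ, a⁆ = ⁅ρ, a⁆ := by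
  rw [Ring.lie_def, star_sub, star_mul, star_mul, hρ, skewAdjoint.mem_iff.mp ha]
  noncomm_ring

theorem half_hsNormSq_le_deriv {ρ a v : CMat n} (hρ : star ρ = ρ)
    (ha : a ∈ skewAdjoint (CMat n)) (hv : v ∈ skewAdjoint (CMat n)) (z : ℂ) :
    z.im ^ 2 / 2 * hsNormSq ⁅ρ, a⁆ ≤
      (z.im * Complex.I * (a * (⁅ρ, v⁆ + ⁅ρ, a⁆ * dressFactor z ρ)).trace).re +
        1 / 2 * hsNormSq v := by
  -- Expand `0 ≤ |(Im z) [ρ, a] - i v|²`.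
  have hK := star_lie_of_skewAdjoint ha hρ
  have hsq : (((z.im : ℂ) • ⁅ρ, a⁆ - Complex.I • v) *
      star ((z.im : ℂ) • ⁅ρ, a⁆ - Complex.I • v)).trace =
      (z.im : ℂ) ^ 2 * (⁅ρ, a⁆ * ⁅ρ, a⁆).trace - 2 * z.im * (Complex.I * (⁅ρ, a⁆ * v).trace) +
        (v * star v).trace := by
    have hcomm := Matrix.trace_mul_comm v ⁅ρ, a⁆
    simp only [star_sub, star_smul, hK, skewAdjoint.mem_iff.mp hv, RCLike.star_def,
      Complex.conj_ofReal, Complex.conj_I, mul_sub, sub_mul, smul_mul_assoc, mul_smul_comm, mul_neg,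
      neg_mul, smul_neg, Matrix.trace_sub, Matrix.trace_neg, Matrix.trace_smul, smul_eq_mul]
    linear_combination -(z.im : ℂ) * Complex.I * hcomm + (v * v).trace * Complex.I_sq
  have him : z.im * Complex.I * ((conj z - z) / 2) = z.im ^ 2 := by
    rw [← neg_sub, Complex.sub_conj]
    push_cast
    linear_combination -(z.im : ℂ) ^ 2 * Complex.I_sq
  have hnonneg := hsNormSq_nonneg ((z.im : ℂ) • ⁅ρ, a⁆ - Complex.I • v)
  rw [hsNormSq_eq_trace, hsq, ← Complex.ofReal_pow, ← Complex.ofReal_ofNat, ← Complex.ofReal_mul,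
    Complex.add_re, Complex.sub_re, Complex.re_ofReal_mul, Complex.re_ofReal_mul,
    ← hsNormSq_eq_trace] at hnonneg
  have hKK : hsNormSq ⁅ρ, a⁆ = (⁅ρ, a⁆ * ⁅ρ, a⁆).trace.re := by rw [hsNormSq_eq_trace, hK]
  rw [trace_mul_lie_add, mul_add, ← mul_assoc _ ((conj z - z) / 2), him, mul_assoc, mul_neg,
    mul_neg, ← Complex.ofReal_pow, Complex.add_re, Complex.neg_re, Complex.re_ofReal_mul,
    Complex.re_ofReal_mul, hKK]
  linarith

theorem IsSchwartz.bounded_pow_mul_half_hsNormSq {v : ℝ → CMat n} (hv : IsSchwartz v) (k : ℕ) :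
    IsBoundedUnder (· ≤ ·) atTop fun x => x ^ k * (1 / 2 * hsNormSq (v x)) := by
  obtain ⟨M, hM0, hM⟩ := exists_hsNormSq_le n
  obtain ⟨C, hC⟩ := hv.hasDecay k 0
  obtain ⟨D, hD⟩ := hv.exists_bound
  refine isBoundedUnder_of_eventually_le (a := 1 / 2 * (M * (D * C))) ?_
  filter_upwards [eventually_ge_atTop 0] with x hx
  have hCx := hC x
  rw [abs_of_nonneg hx] at hCx
  calc x ^ k * (1 / 2 * hsNormSq (v x)) ≤ x ^ k * (1 / 2 * (M * ‖v x‖ ^ 2)) := by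
        gcongr; exact hM _
    _ = 1 / 2 * (M * (‖v x‖ * (x ^ k * ‖v x‖))) := by ring
    _ ≤ _ := by gcongr; exacts [(norm_nonneg _).trans (hD x), hD x]

namespace IsProjectionFlow

variable {z : ℂ} {v ρ : ℝ → CMat n}

theorem comp_neg {a : CMat n} (h : IsProjectionFlow z a v ρ) :
    IsProjectionFlow z (-a) (fun x => -v (-x)) fun x => ρ (-x) where
  isStarProjection x := h.isStarProjection (-x)
  hasDerivAt x := by
    refine ((h.hasDerivAt (-x)).scomp x (hasDerivAt_neg x)).congr_deriv ?_
    simp only [Ring.lie_def, neg_smul, one_smul]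
    noncomm_ring

theorem hasDecay_zero {a : CMat n} (h : IsProjectionFlow z a v ρ) : HasDecay 0 0 ρ :=
  ⟨1, fun x => by simpa using (h.isStarProjection x).norm_le⟩

variable {α : Fin n → ℂ}

theorem exists_isGradientLike (h : IsProjectionFlow z (Matrix.diagonal α) v ρ) (hz : z.im ≠ 0)
    (hα : Matrix.diagonal α ∈ skewAdjoint (CMat n)) (hv : IsSchwartz v)
    (hv' : ∀ x, v x ∈ skewAdjoint (CMat n)) :
    ∃ K S G, IsGradientLike (z.im ^ 2 / 2) K S G (fun x => hsNormSq ⁅ρ x, Matrix.diagonal α⁆)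
      fun x => 1 / 2 * hsNormSq (v x) := by
  let L : CMat n →L[ℂ] ℂ := ((z.im * Complex.I) • Matrix.traceLinearMap (Fin n) ℂ ℂ ∘ₗ
    LinearMap.mulLeft ℂ (Matrix.diagonal α)).toContinuousLinearMap
  let L' : CMat n →L[ℝ] ℝ := Complex.reCLM.comp (L.restrictScalars ℝ)
  obtain ⟨S, K, hS, hnear⟩ := exists_finite_near_trace α
  refine ⟨|z.im| * K, (fun s => (z.im * Complex.I * s).re) '' S, fun x => L' (ρ x), ?_⟩
  constructor
  case rate_pos => positivity
  case finite => exact hS.image _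
  case bounded =>
    obtain ⟨C, hC⟩ := (h.hasDecay_zero.clm_apply L').exists_bound
    exact isBoundedUnder_of ⟨C, fun x => (le_abs_self _).trans (hC x)⟩
  case nonneg => exact fun x => hsNormSq_nonneg _
  case exists_near =>
    intro x
    obtain ⟨s, hs, hle⟩ := hnear (ρ x) (h.isStarProjection x)
    refine ⟨_, ⟨s, hs, rfl⟩, ?_⟩
    calc |L' (ρ x) - (z.im * Complex.I * s).re|
        = |(z.im * Complex.I * ((Matrix.diagonal α * ρ x).trace - s)).re| := by
          rw [mul_sub, Complex.sub_re]; rfl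
      _ ≤ |z.im| * ‖(Matrix.diagonal α * ρ x).trace - s‖ := by
          refine (Complex.abs_re_le_norm _).trans_eq ?_
          simp
      _ ≤ _ := by rw [mul_assoc]; gcongr
  case exists_deriv =>
    exact fun x => ⟨_, L'.hasFDerivAt.comp_hasDerivAt x (h.hasDerivAt x),
      half_hsNormSq_le_deriv (h.isStarProjection x).isSelfAdjoint.star_eq hα (hv' x) z⟩
  case rapid => exact hv.bounded_pow_mul_half_hsNormSq

theorem bounded_pow_mul_hsNormSq (h : IsProjectionFlow z (Matrix.diagonal α) v ρ) (hz : z.im ≠ 0)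
    (hα : Matrix.diagonal α ∈ skewAdjoint (CMat n)) (hv : IsSchwartz v)
    (hv' : ∀ x, v x ∈ skewAdjoint (CMat n)) (k : ℕ) :
    IsBoundedUnder (· ≤ ·) atTop fun x => x ^ k * hsNormSq ⁅ρ x, Matrix.diagonal α⁆ := by
  obtain ⟨K, S, G, hG⟩ := h.exists_isGradientLike hz hα hv hv'
  let T : CMat n →L[ℂ] ℂ := (Matrix.traceLinearMap (Fin n) ℂ ℂ).toContinuousLinearMap
  have hρ : HasDecay 0 1 ρ := ⟨h.hasDecay_zero, _, h.hasDerivAt,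
    hv.hasDecay_lie_add h.hasDecay_zero (h.hasDecay_zero.lie (.const 0 _)) z⟩
  have hK : HasDecay 0 1 fun x => ⁅ρ x, Matrix.diagonal α⁆ := hρ.lie (.const 1 _)
  have hTK := (hK.mul hK).clm_apply (Complex.reCLM.comp (T.restrictScalars ℝ))
  obtain ⟨C, hC⟩ := hTK.exists_bound
  obtain ⟨-, N', hN', hN'_decay⟩ := hTK
  obtain ⟨C', hC'⟩ := hN'_decay.exists_bound
  have hN : ∀ x, hsNormSq ⁅ρ x, Matrix.diagonal α⁆ =
      (⁅ρ x, Matrix.diagonal α⁆ * ⁅ρ x, Matrix.diagonal α⁆).trace.re := fun x => by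
    rw [hsNormSq_eq_trace, star_lie_of_skewAdjoint hα (h.isStarProjection x).isSelfAdjoint.star_eq]
  simp only [hN] at hG ⊢
  refine hG.bounded_pow_mul (B := max C C') (fun x => ?_) hN' (fun x => ?_) k
  · exact le_max_of_le_left ((le_abs_self _).trans (hC x))
  · exact le_max_of_le_right (hC' x)

theorem hasDecay_lie_zero (h : IsProjectionFlow z (Matrix.diagonal α) v ρ) (hz : z.im ≠ 0)
    (hα : Matrix.diagonal α ∈ skewAdjoint (CMat n)) (hv : IsSchwartz v)
    (hv' : ∀ x, v x ∈ skewAdjoint (CMat n)) (k : ℕ) :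
    HasDecay k 0 fun x => ⁅ρ x, Matrix.diagonal α⁆ := by
  obtain ⟨B, hB⟩ := (h.hasDecay_zero.lie (.const 0 (Matrix.diagonal α))).exists_bound
  obtain ⟨M, hM0, hM⟩ := exists_norm_sq_le_hsNormSq n
  obtain ⟨C, hC⟩ := h.bounded_pow_mul_hsNormSq hz hα hv hv' (2 * k)
  have hneg := h.comp_neg
  rw [Matrix.diagonal_neg] at hneg
  obtain ⟨D, hD⟩ := hneg.bounded_pow_mul_hsNormSq hz (Matrix.diagonal_neg α ▸ neg_mem hα)
    hv.comp_neg.neg (fun x => neg_mem (hv' _)) (2 * k)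
  obtain ⟨R, hR⟩ := eventually_atTop.mp ((eventually_map.mp hC).and (eventually_map.mp hD))
  refine ⟨max (1 + M * max C D) (R ^ k * B), fun x => ?_⟩
  rcases le_total R |x| with hx | hx
  · refine le_max_of_le_left ?_
    have hN : |x| ^ (2 * k) * hsNormSq ⁅ρ x, Matrix.diagonal α⁆ ≤ max C D := by
      rcases abs_choice x with hx' | hx'
      · exact le_max_of_le_left (by simpa [hx'] using (hR _ hx).1)
      · refine le_max_of_le_right ?_
        simpa [hx', ← Matrix.diagonal_neg, hsNormSq_lie_neg] using (hR _ hx).2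
    have hsq : (|x| ^ k * ‖⁅ρ x, Matrix.diagonal α⁆‖) ^ 2 ≤ M * max C D :=
      calc _ = |x| ^ (2 * k) * ‖⁅ρ x, Matrix.diagonal α⁆‖ ^ 2 := by ring
        _ ≤ |x| ^ (2 * k) * (M * hsNormSq ⁅ρ x, Matrix.diagonal α⁆) := by gcongr; exact hM _
        _ = M * (|x| ^ (2 * k) * hsNormSq ⁅ρ x, Matrix.diagonal α⁆) := by ring
        _ ≤ _ := by gcongr
    nlinarith [sq_nonneg (|x| ^ k * ‖⁅ρ x, Matrix.diagonal α⁆‖ - 1)]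
  · refine le_max_of_le_right ?_
    exact mul_le_mul (pow_le_pow_left₀ (abs_nonneg x) hx k) (hB x) (norm_nonneg _)
      (pow_nonneg ((abs_nonneg x).trans hx) k)

-- The `x`-equation bounds one more derivative of `ρ` at each step.
theorem hasDecay_succ_of_hasDecay {a : CMat n} (h : IsProjectionFlow z a v ρ) (hv : IsSchwartz v)
    (hK : ∀ k, HasDecay k 0 fun x => ⁅ρ x, a⁆) (m : ℕ) :
    HasDecay 0 m ρ ∧ ∀ k, HasDecay k m fun x => ⁅ρ x, a⁆ := by
  induction m with
  | zero => exact ⟨h.hasDecay_zero, hK⟩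
  | succ m ih =>
    have hρ' := fun k => hv.hasDecay_lie_add ih.1 (ih.2 k) z
    exact ⟨⟨h.hasDecay_zero, _, h.hasDerivAt, hρ' 0⟩, fun k => ⟨hK k, _, fun x =>
      ((h.hasDerivAt x).mul_const a).sub ((h.hasDerivAt x).const_mul a), (hρ' k).lie (.const m a)⟩⟩

theorem isSchwartz_lie (h : IsProjectionFlow z (Matrix.diagonal α) v ρ) (hz : z.im ≠ 0)
    (hα : Matrix.diagonal α ∈ skewAdjoint (CMat n)) (hv : IsSchwartz v)
    (hv' : ∀ x, v x ∈ skewAdjoint (CMat n)) :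
    IsSchwartz fun x => ⁅ρ x, Matrix.diagonal α⁆ :=
  isSchwartz_of_hasDecay fun k m =>
    (h.hasDecay_succ_of_hasDecay hv (h.hasDecay_lie_zero hz hα hv hv') m).2 k

end IsProjectionFlow

theorem tendsto_lie_aeval {A : Type*} [NormedRing A] [NormedAlgebra ℂ A] {X : Type*} {l : Filter X}
    {a : A} {g : X → A} (h : Tendsto (fun x => ⁅g x, a⁆) l (𝓝 0)) (p : Polynomial ℂ) :
    Tendsto (fun x => ⁅g x, Polynomial.aeval a p⁆) l (𝓝 0) := by
  have hmem := Polynomial.aeval_mem_adjoin_singleton ℂ a (p := p)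
  generalize Polynomial.aeval a p = b at hmem ⊢
  induction hmem using Algebra.adjoin_induction with
  | mem b hb => rwa [Set.mem_singleton_iff.mp hb]
  | algebraMap c => simpa [Ring.lie_def, Algebra.commutes] using tendsto_const_nhds
  | add b c _ _ hb hc => simpa [Ring.lie_def, mul_add, add_mul, add_sub_add_comm] using hb.add hc
  | mul b c _ _ hb hc =>
    have hmul := (hb.mul_const c).add (hc.const_mul b)
    simp only [zero_mul, mul_zero, add_zero] at hmul
    refine hmul.congr fun x => ?_
    simp only [Ring.lie_def]
    noncomm_ring

end ProjectionFlow

section PlaneForm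

theorem hasDerivAt_prodMk_right (x t : ℝ) : HasDerivAt (fun y : ℝ => (y, t)) (1, 0) x :=
  (hasDerivAt_id x).prodMk (hasDerivAt_const x t)

theorem hasDerivAt_prodMk_left (x t : ℝ) : HasDerivAt (fun s : ℝ => (x, s)) (0, 1) t :=
  (hasDerivAt_const t x).prodMk (hasDerivAt_id t)

theorem hasFDerivAt_prod_iff {V : Type*} [NormedAddCommGroup V] [NormedSpace ℝ V] {F : ℝ × ℝ → V}
    {L : ℝ × ℝ →L[ℝ] V} {x t : ℝ} :
    HasFDerivAt F L (x, t) ↔ DifferentiableAt ℝ F (x, t) ∧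
      HasDerivAt (fun y => F (y, t)) (L (1, 0)) x ∧
      HasDerivAt (fun s => F (x, s)) (L (0, 1)) t := by
  have hx := hasDerivAt_prodMk_right x t
  have ht := hasDerivAt_prodMk_left x t
  refine ⟨fun h => ⟨h.differentiableAt, h.comp_hasDerivAt x hx, h.comp_hasDerivAt t ht⟩,
    fun ⟨hF, hFx, hFt⟩ => hF.hasFDerivAt.congr_fderiv ?_⟩
  ext
  · simpa using (hF.hasFDerivAt.comp_hasDerivAt x hx).unique hFx
  · simpa using (hF.hasFDerivAt.comp_hasDerivAt t ht).unique hFt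

/-- The one-form `X dx + T dt` on the `(x, t)`-plane. -/
noncomputable def planeForm {V : Type*} [NormedAddCommGroup V] [NormedSpace ℝ V] (X T : V) :
    ℝ × ℝ →L[ℝ] V :=
  (ContinuousLinearMap.fst ℝ ℝ ℝ).smulRight X + (ContinuousLinearMap.snd ℝ ℝ ℝ).smulRight T

section Normed

variable {V : Type*} [NormedAddCommGroup V] [NormedSpace ℝ V] (X T : V)

@[simp]
theorem planeForm_apply_fst : planeForm X T (1, 0) = X := by simp [planeForm]

@[simp]
theorem planeForm_apply_snd : planeForm X T (0, 1) = T := by simp [planeForm]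

theorem eq_planeForm (L : ℝ × ℝ →L[ℝ] V) : L = planeForm (L (1, 0)) (L (0, 1)) := by
  ext <;> simp

theorem planeForm_mem_skewAdjoint {A : Type*} [NormedRing A] [NormedAlgebra ℝ A] [StarRing A]
    [StarModule ℝ A] {X T : A} (hX : X ∈ skewAdjoint A) (hT : T ∈ skewAdjoint A) (h : ℝ × ℝ) :
    planeForm X T h ∈ skewAdjoint A :=
  add_mem (skewAdjoint.smul_mem h.1 hX) (skewAdjoint.smul_mem h.2 hT)

end Normed

end PlaneForm

section LinearCoeff

/-- The coefficients of the polynomial `c₀ + c₁ ξ`. -/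
def linearCoeff {M : Type*} [Zero M] (c₀ c₁ : M) : ℕ → M
  | 0 => c₀
  | 1 => c₁
  | _ + 2 => 0

theorem sum_linearCoeff {M N : Type*} [Zero M] [AddCommMonoid N] (c₀ c₁ : M) {j : ℕ} (hj : 1 ≤ j)
    {f : ℕ → M → N} (hf : ∀ k, f k 0 = 0) :
    ∑ k ∈ Finset.range (j + 1), f k (linearCoeff c₀ c₁ k) = f 0 c₀ + f 1 c₁ := by
  obtain ⟨i, rfl⟩ := Nat.exists_eq_add_of_le' hj
  have hzero : ∀ k ∈ Finset.range i, f (k + 1 + 1) (linearCoeff c₀ c₁ (k + 1 + 1)) = 0 :=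
    fun k _ => hf (k + 2)
  rw [Finset.sum_range_succ', Finset.sum_range_succ', Finset.sum_eq_zero hzero, zero_add, add_comm]
  rfl

theorem dressCoeff_linearCoeff {R : Type*} [Ring R] (g v a : R) {j : ℕ} (hj : 1 ≤ j) (k : ℕ) :
    dressCoeff g (linearCoeff v a) (j + 1) k = linearCoeff (v - ⁅g, a⁆) a k := by
  have hzero : ∀ i l, ⁅g, (0 : R)⁆ * g ^ l = 0 ∧ linearCoeff v a (i + 2) = 0 := fun i l =>
    ⟨by simp [Ring.lie_def], rfl⟩
  rcases k with _ | k
  · rw [dressCoeff,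
      Finset.sum_eq_single_of_mem 0 (Finset.mem_range.mpr (by omega)) fun l _ hl => ?_]
    · simp [linearCoeff]
    · obtain ⟨i, rfl⟩ := Nat.exists_eq_succ_of_ne_zero hl
      rw [show 0 + 1 + (i + 1) = i + 2 by omega, (hzero i (i + 1)).2, (hzero i _).1]
  · rw [dressCoeff, Finset.sum_eq_zero fun l _ => ?_, sub_zero]
    · cases k <;> rfl
    · rw [show k + 1 + 1 + l = k + l + 2 by omega, (hzero (k + l) l).2, (hzero l l).1]

end LinearCoeff

section Potential

open scoped Matrix.Norms.L2Operator

variable {n : ℕ} {α : Fin n → ℂ} {b : CMat n} {j : ℕ} {u : ℝ → ℝ → CMat n}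

theorem trace_mul_lie_eq_zero {a X : CMat n} (h : Commute a X) (Y : CMat n) :
    (X * ⁅Y, a⁆).trace = 0 := by
  rw [Ring.lie_def, mul_sub, Matrix.trace_sub, sub_eq_zero, ← mul_assoc, Matrix.trace_mul_comm,
    ← mul_assoc, h.eq, mul_assoc]

theorem centralizerPart_mem_skewAdjoint {v : CMat n} (hv : v ∈ skewAdjoint (CMat n)) :
    centralizerPart α v ∈ skewAdjoint (CMat n) := by
  refine skewAdjoint.mem_iff.mpr (Matrix.ext fun i k => ?_)
  have hik := Matrix.ext_iff.mpr (skewAdjoint.mem_iff.mp hv) i k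
  rw [Matrix.star_apply, Matrix.neg_apply] at hik ⊢
  by_cases h : α i = α k
  · simpa [centralizerPart, h] using hik
  · simp [centralizerPart, h, Ne.symm h]

open scoped ComplexOrder in
theorem centralizerPart_eq_zero_of_mem_unitaryPerp {v : CMat n}
    (hv : v ∈ unitaryPerp (Matrix.diagonal α)) : centralizerPart α v = 0 := by
  let c := centralizerPart α v
  have hc : c ∈ skewAdjoint (CMat n) := centralizerPart_mem_skewAdjoint hv.1
  have hcomm : Commute (Matrix.diagonal α) c := (commute_centralizerPart v).symm
  have hcc : (c * c).trace = 0 := by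
    have hoff := trace_mul_lie_eq_zero hcomm (-adInv α v)
    rwa [lie_neg_adInv_diagonal, mul_sub, Matrix.trace_sub, hv.2 c hc hcomm, zero_sub,
      neg_eq_zero] at hoff
  rw [← Matrix.trace_mul_conjTranspose_self_eq_zero_iff, ← Matrix.star_eq_conjTranspose,
    skewAdjoint.mem_iff.mp hc, mul_neg, Matrix.trace_neg, hcc, neg_zero]

theorem add_smul_lie_mem_unitaryPerp {a v ρ : CMat n} (ha : a ∈ skewAdjoint (CMat n))
    (hv : v ∈ unitaryPerp a) (hρ : star ρ = ρ) (z : ℂ) :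
    v + (z - conj z) • ⁅ρ, a⁆ ∈ unitaryPerp a := by
  refine ⟨add_mem hv.1 (skewAdjoint.mem_iff.mpr ?_), fun x hx hc => ?_⟩
  · rw [star_smul, star_lie_of_skewAdjoint ha hρ, ← neg_smul]
    simp
  · rw [mul_add, Matrix.trace_add, hv.2 x hx hc, mul_smul_comm, Matrix.trace_smul,
      trace_mul_lie_eq_zero hc, smul_zero, add_zero]

/-- A smooth map from the `(x, t)`-plane to `𝒰_a^⊥`, `a = diag(α)`, which is in the Schwartz class
in `x` for every `t`. -/
structure IsPotential (α : Fin n → ℂ) (u : ℝ → ℝ → CMat n) : Prop where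
  contDiff : ContDiff ℝ ∞ fun w : ℝ × ℝ => u w.1 w.2
  mem_perp : ∀ x t, u x t ∈ unitaryPerp (Matrix.diagonal α)
  isSchwartz : ∀ t, IsSchwartz (u · t)

namespace IsPotential

variable (hu : IsPotential α u)

include hu

theorem centralizerPart_eq_zero (x t : ℝ) : centralizerPart α (u x t) = 0 :=
  centralizerPart_eq_zero_of_mem_unitaryPerp (hu.mem_perp x t)

theorem isFluxSequence (hab : Commute b (Matrix.diagonal α)) (t : ℝ) :
    IsFluxSequence (Matrix.diagonal α) b (u · t) fun k x => fluxAt α b u k x t :=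
  isFluxSequence_fluxQ (hu.isSchwartz t) (hu.centralizerPart_eq_zero · t) hab

theorem fluxAt_mem_skewAdjoint (ha : Matrix.diagonal α ∈ skewAdjoint (CMat n))
    (hb : b ∈ skewAdjoint (CMat n)) (hab : Commute b (Matrix.diagonal α)) (k : ℕ) (x t : ℝ) :
    fluxAt α b u k x t ∈ skewAdjoint (CMat n) := by
  have hQ := hu.isFluxSequence hab t
  have hQ' := hQ.neg_star ha hb fun x => (hu.mem_perp x t).1
  have hkx := congrFun (congrFun (hQ.unique (hu.centralizerPart_eq_zero · t) hQ') k) x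
  exact skewAdjoint.mem_iff.mpr (neg_eq_iff_eq_neg.mp hkx.symm)

end IsPotential

theorem isFlowSolution_iff (hab : Commute b (Matrix.diagonal α)) :
    IsFlowSolution α b j u ↔ IsPotential α u ∧
      ∀ x t, HasDerivAt (u x ·) ⁅fluxAt α b u (j + 1) x t, Matrix.diagonal α⁆ t := by
  have hderiv : IsPotential α u → ∀ x t, matDeriv (fun y => fluxAt α b u j y t) x +
      ⁅u x t, fluxAt α b u j x t⁆ = ⁅fluxAt α b u (j + 1) x t, Matrix.diagonal α⁆ :=
    fun hu x t => by
      rw [matDeriv_eq ((hu.isFluxSequence hab t).hasDerivAt j x), sub_add_cancel]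
  constructor
  · intro h
    have hu : IsPotential α u := ⟨matSmooth_iff_contDiff.mp h.smooth, h.mem_perp, fun t =>
      isSchwartz_iff_entry.mpr (h.schwartz t)⟩
    refine ⟨hu, fun x t => ?_⟩
    have hut : HasDerivAt (u x ·) _ t := ((hasFDerivAt_prod_iff.mp
      (hu.contDiff.differentiable (by simp) (x, t)).hasFDerivAt).2.2)
    rwa [← hderiv hu, ← h.flow, matDeriv_eq hut]
  · rintro ⟨hu, hflow⟩
    exact ⟨matSmooth_iff_contDiff.mpr hu.contDiff, hu.mem_perp, fun t =>
      isSchwartz_iff_entry.mp (hu.isSchwartz t), fun x t => by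
        rw [matDeriv_eq (hflow x t), hderiv hu]⟩

end Potential

section FlowForm

open scoped Matrix.Norms.L2Operator
open Set

variable {n : ℕ} {α : Fin n → ℂ} {b : CMat n} {j : ℕ} {u : ℝ → ℝ → CMat n}

/-- The coefficient of `ξ ^ k` in the flat connection form `(aξ + u) dx + (∑ Q_{b,j-k}(u) ξ^k) dt`
of the `j`-th flow, for `k ≤ j`; for larger `k`, where the subtraction `j - k` truncates, it plays
no role. -/
noncomputable def flowForm (α : Fin n → ℂ) (b : CMat n) (j : ℕ) (u : ℝ → ℝ → CMat n) (k : ℕ)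
    (w : ℝ × ℝ) : ℝ × ℝ →L[ℝ] CMat n :=
  planeForm (linearCoeff (u w.1 w.2) (Matrix.diagonal α) k) (fluxAt α b u (j - k) w.1 w.2)

theorem pencil_flowForm_fst (hj : 1 ≤ j) (ξ : ℂ) (w : ℝ × ℝ) :
    pencil (flowForm α b j u) (j + 1) ξ w (1, 0) = ξ • Matrix.diagonal α + u w.1 w.2 := by
  simpa [pencil, flowForm, add_comm] using sum_linearCoeff (u w.1 w.2) (Matrix.diagonal α) hj
    (f := fun k (M : CMat n) => ξ ^ k • M) fun k => smul_zero _

theorem pencil_flowForm_snd (ξ : ℂ) (w : ℝ × ℝ) :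
    pencil (flowForm α b j u) (j + 1) ξ w (0, 1) =
      ∑ k ∈ Finset.range (j + 1), ξ ^ k • fluxAt α b u (j - k) w.1 w.2 := by
  simp [pencil, flowForm]

theorem IsPotential.flowForm_mem_skewAdjoint (hu : IsPotential α u)
    (ha : Matrix.diagonal α ∈ skewAdjoint (CMat n)) (hb : b ∈ skewAdjoint (CMat n))
    (hab : Commute b (Matrix.diagonal α)) (k : ℕ) (w h : ℝ × ℝ) :
    flowForm α b j u k w h ∈ skewAdjoint (CMat n) := by
  refine planeForm_mem_skewAdjoint ?_ (hu.fluxAt_mem_skewAdjoint ha hb hab _ _ _) h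
  match k with
  | 0 => exact (hu.mem_perp w.1 w.2).1
  | 1 => exact ha
  | _ + 2 => exact zero_mem _

namespace IsTrivialization

variable {E : ℝ → ℝ → ℂ → CMat n} (hE : IsTrivialization α b j u E)

include hE

theorem contDiff (ξ : ℂ) : ContDiff ℝ ∞ fun w : ℝ × ℝ => E w.1 w.2 ξ :=
  matSmooth_iff_contDiff.mp (hE.smooth ξ)

theorem isFundamentalSolution (hj : 1 ≤ j) (ξ : ℂ) :
    IsFundamentalSolution (pencil (flowForm α b j u) (j + 1) ξ) fun w => E w.1 w.2 ξ := by
  refine ⟨fun ⟨x, t⟩ => ?_, hE.init ξ⟩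
  have hd := (hE.contDiff ξ).differentiable (by simp) (x, t)
  obtain ⟨-, hx, ht⟩ := hasFDerivAt_prod_iff.mp hd.hasFDerivAt
  refine hasFDerivAt_prod_iff.mpr ⟨hd, hx.congr_deriv ?_, ht.congr_deriv ?_⟩
  · rw [smul_apply, pencil_flowForm_fst hj, smul_eq_mul, ← hE.deriv_x, matDeriv_eq hx]
  · rw [smul_apply, pencil_flowForm_snd, smul_eq_mul, ← hE.deriv_t, matDeriv_eq ht]

variable (hu : IsPotential α u) (hj : 1 ≤ j) (ha : Matrix.diagonal α ∈ skewAdjoint (CMat n))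
  (hb : b ∈ skewAdjoint (CMat n)) (hab : Commute b (Matrix.diagonal α))

include hu hj ha hb hab

theorem contDiff_flowForm (k : ℕ) : ContDiff ℝ ∞ (flowForm α b j u k) := by
  by_cases hk : k < j + 1
  · exact contDiff_coeff_of_isFundamentalSolution (hu.flowForm_mem_skewAdjoint ha hb hab)
      (hE.isFundamentalSolution hj) hE.contDiff hk
  · obtain ⟨i, rfl⟩ : ∃ i, k = i + 2 := ⟨k - 2, by omega⟩
    have hconst : flowForm α b j u (i + 2) = fun _ => planeForm 0 b := funext fun w => by
      rw [flowForm, Nat.sub_eq_zero_of_le (by omega)]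
      rfl
    exact hconst ▸ contDiff_const

theorem isSkewPencilSolution :
    IsSkewPencilSolution (flowForm α b j u) (j + 1) univ fun ξ w => E w.1 w.2 ξ where
  continuous_coeff k := (hE.contDiff_flowForm hu hj ha hb hab k).continuous
  skew_coeff := hu.flowForm_mem_skewAdjoint ha hb hab
  conj_mem ξ _ := mem_univ (conj ξ)
  solution ξ _ := hE.isFundamentalSolution hj ξ

end IsTrivialization

theorem isTrivialization_of_isFundamentalSolution {F : ℂ → ℝ × ℝ → CMat n} (hj : 1 ≤ j)
    (hs : ∀ k, ContDiff ℝ ∞ (flowForm α b j u k))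
    (hF : ∀ ξ, IsFundamentalSolution (pencil (flowForm α b j u) (j + 1) ξ) (F ξ)) :
    IsTrivialization α b j u fun x t ξ => F ξ (x, t) where
  smooth ξ := matSmooth_iff_contDiff.mpr <|
    (hF ξ).contDiff (ContDiff.sum fun k _ => (hs k).const_smul (ξ ^ k))
  deriv_x x t ξ := by
    rw [matDeriv_eq (hasFDerivAt_prod_iff.mp ((hF ξ).hasFDerivAt (x, t))).2.1, smul_apply,
      pencil_flowForm_fst hj, smul_eq_mul]
  deriv_t x t ξ := by
    rw [matDeriv_eq (hasFDerivAt_prod_iff.mp ((hF ξ).hasFDerivAt (x, t))).2.2, smul_apply,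
      pencil_flowForm_snd, smul_eq_mul]
  init ξ := (hF ξ).map_zero

end FlowForm

section FlowDressing

open scoped Matrix.Norms.L2Operator
open Set

variable {n : ℕ} {α : Fin n → ℂ} {b : CMat n} {j : ℕ} {z : ℂ}

theorem commute_aeval_self {R : Type*} [Ring R] [Algebra ℂ R] (a : R) (p : Polynomial ℂ) :
    Commute (Polynomial.aeval a p) a := by
  simpa using ((Polynomial.commute_X p).map (Polynomial.aeval a)).symm

namespace IsProjectionFlow

theorem hasDerivAt_dressFactor {A : Type*} [CStarAlgebra A] {a : A} {v ρ : ℝ → A}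
    (h : IsProjectionFlow z a v ρ) (x : ℝ) :
    HasDerivAt (fun x => dressFactor z (ρ x))
      (dressFactor z (ρ x) * v x - (v x + ⁅a, dressFactor z (ρ x)⁆) * dressFactor z (ρ x)) x := by
  refine (((h.hasDerivAt x).const_smul (conj z - z)).const_add (z • (1 : A))).congr_deriv ?_
  rw [smul_add, ← smul_mul_assoc, ← dressFactor_lie, ← dressFactor_lie]
  simp only [Ring.lie_def]
  noncomm_ring

variable {v ρ : ℝ → CMat n}

theorem isFluxSequence_dress (h : IsProjectionFlow z (Matrix.diagonal α) v ρ) (hz : z.im ≠ 0)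
    (ha : Matrix.diagonal α ∈ skewAdjoint (CMat n)) (hv : IsSchwartz v)
    (hv' : ∀ x, v x ∈ skewAdjoint (CMat n))
    (hb : ∃ p : Polynomial ℂ, b = Polynomial.aeval (Matrix.diagonal α : CMat n) p)
    {Q : ℕ → ℝ → CMat n} (hQ : IsFluxSequence (Matrix.diagonal α) b v Q) :
    IsFluxSequence (Matrix.diagonal α) b
      (fun x => v x + (z - conj z) • ⁅ρ x, (Matrix.diagonal α : CMat n)⁆)
      fun k x => dressFlux (dressFactor z (ρ x)) (Q · x) k := by
  obtain ⟨p, rfl⟩ := hb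
  simp only [← lie_dressFactor]
  refine hQ.dress (commute_aeval_self _ p).symm h.hasDerivAt_dressFactor
    (h.hasDecay_zero.dressFactor z).exists_bound ?_
  simp only [lie_dressFactor]
  simpa using (tendsto_lie_aeval (h.isSchwartz_lie hz ha hv hv').tendsto_atBot p).const_smul
    (z - conj z)

end IsProjectionFlow

/-- The data of the theorem: a solution `u` of the `j`-th flow, its trivialization `E`, a non-real
pole `z`, and the projections `ρ x t` obtained from `p` by the action of `E x t z`. -/
structure IsFlowDressing (α : Fin n → ℂ) (b : CMat n) (j : ℕ) (u : ℝ → ℝ → CMat n)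
    (E : ℝ → ℝ → ℂ → CMat n) (z : ℂ) (p : CMat n) (ρ : ℝ → ℝ → CMat n) : Prop where
  one_le : 1 ≤ j
  diagonal_mem : Matrix.diagonal α ∈ skewAdjoint (CMat n)
  mem_skewAdjoint : b ∈ skewAdjoint (CMat n)
  exists_aeval : ∃ f : Polynomial ℂ, b = Polynomial.aeval (Matrix.diagonal α : CMat n) f
  isFlowSolution : IsFlowSolution α b j u
  isTrivialization : IsTrivialization α b j u E
  im_ne_zero : z.im ≠ 0
  isDressingProjection :
    IsDressingProjection (fun ξ (w : ℝ × ℝ) => E w.1 w.2 ξ) z p fun w => ρ w.1 w.2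

/-- The Bäcklund transform `u + (z - z̄)[ρ, a]`, `a = diag(α)`. -/
noncomputable def dressedPotential (α : Fin n → ℂ) (z : ℂ) (u ρ : ℝ → ℝ → CMat n) (x t : ℝ) :
    CMat n :=
  u x t + (z - conj z) • ⁅ρ x t, (Matrix.diagonal α : CMat n)⁆

namespace IsFlowDressing

variable {u : ℝ → ℝ → CMat n} {E : ℝ → ℝ → ℂ → CMat n} {p : CMat n} {ρ : ℝ → ℝ → CMat n}
  (h : IsFlowDressing α b j u E z p ρ)

include h

theorem commute : Commute b (Matrix.diagonal α) := by
  obtain ⟨f, rfl⟩ := h.exists_aeval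
  exact commute_aeval_self _ f

theorem isPotential : IsPotential α u := ((isFlowSolution_iff h.commute).mp h.isFlowSolution).1

theorem contDiff_flowForm (k : ℕ) : ContDiff ℝ ∞ (flowForm α b j u k) :=
  h.isTrivialization.contDiff_flowForm h.isPotential h.one_le h.diagonal_mem h.mem_skewAdjoint
    h.commute k

theorem isSkewPencilSolution :
    IsSkewPencilSolution (flowForm α b j u) (j + 1) univ fun ξ w => E w.1 w.2 ξ :=
  h.isTrivialization.isSkewPencilSolution h.isPotential h.one_le h.diagonal_mem h.mem_skewAdjoint
    h.commute

theorem star_eq (x t : ℝ) : star (ρ x t) = ρ x t := h.isDressingProjection.star_eq (x, t)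

theorem mul_self (x t : ℝ) : ρ x t * ρ x t = ρ x t := h.isDressingProjection.mul_self (x, t)

theorem contDiff_projection : ContDiff ℝ ∞ fun w : ℝ × ℝ => ρ w.1 w.2 :=
  h.isDressingProjection.contDiff h.isTrivialization.contDiff

theorem hasDerivAt_fst (x t : ℝ) :
    HasDerivAt (ρ · t)
      (⁅ρ x t, u x t⁆ + ⁅ρ x t, (Matrix.diagonal α : CMat n)⁆ * dressFactor z (ρ x t)) x := by
  refine (h.isDressingProjection.hasDerivAt_comp h.isSkewPencilSolution
    (hasDerivAt_prodMk_right x t)).congr_deriv ?_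
  simpa [flowForm] using sum_linearCoeff (u x t) (Matrix.diagonal α) h.one_le
    (f := fun k M => ⁅ρ x t, M⁆ * dressFactor z (ρ x t) ^ k) fun k => by simp [Ring.lie_def]

theorem hasDerivAt_snd (x t : ℝ) :
    HasDerivAt (ρ x ·) (∑ k ∈ Finset.range (j + 1),
      ⁅ρ x t, fluxAt α b u (j - k) x t⁆ * dressFactor z (ρ x t) ^ k) t := by
  refine (h.isDressingProjection.hasDerivAt_comp h.isSkewPencilSolution
    (hasDerivAt_prodMk_left x t)).congr_deriv ?_
  simp [flowForm]

theorem isProjectionFlow (t : ℝ) : IsProjectionFlow z (Matrix.diagonal α) (u · t) (ρ · t) where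
  isStarProjection x := ⟨h.mul_self x t, h.star_eq x t⟩
  hasDerivAt x := h.hasDerivAt_fst x t

theorem isPotential_dressedPotential : IsPotential α (dressedPotential α z u ρ) where
  contDiff := by
    have hρ := h.contDiff_projection
    have hlie : ContDiff ℝ ∞ fun w : ℝ × ℝ => ⁅ρ w.1 w.2, (Matrix.diagonal α : CMat n)⁆ :=
      (hρ.mul contDiff_const).sub (contDiff_const.mul hρ)
    exact h.isPotential.contDiff.add (hlie.const_smul (z - conj z))
  mem_perp x t :=
    add_smul_lie_mem_unitaryPerp h.diagonal_mem (h.isPotential.mem_perp x t) (h.star_eq x t) z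
  isSchwartz t :=
    (h.isPotential.isSchwartz t).add <|
      ((h.isProjectionFlow t).isSchwartz_lie h.im_ne_zero h.diagonal_mem
        (h.isPotential.isSchwartz t) fun x => (h.isPotential.mem_perp x t).1).clm_apply
        (((z - conj z) • ContinuousLinearMap.id ℂ (CMat n)).restrictScalars ℝ)

theorem fluxAt_dressedPotential (k : ℕ) (x t : ℝ) :
    fluxAt α b (dressedPotential α z u ρ) k x t =
      dressFlux (dressFactor z (ρ x t)) (fun k => fluxAt α b u k x t) k := by
  have hQ := (h.isProjectionFlow t).isFluxSequence_dress h.im_ne_zero h.diagonal_mem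
    (h.isPotential.isSchwartz t) (fun x => (h.isPotential.mem_perp x t).1) h.exists_aeval
    (h.isPotential.isFluxSequence h.commute t)
  have hQ' := h.isPotential_dressedPotential.isFluxSequence h.commute t
  exact congrFun (congrFun (hQ'.unique
    (h.isPotential_dressedPotential.centralizerPart_eq_zero · t) hQ) k) x

theorem isFlowSolution_dressedPotential : IsFlowSolution α b j (dressedPotential α z u ρ) := by
  refine (isFlowSolution_iff h.commute).mpr ⟨h.isPotential_dressedPotential, fun x t => ?_⟩
  let g := dressFactor z (ρ x t)
  let Q := fun k => fluxAt α b u k x t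
  have hg : (conj z - z) • ∑ k ∈ Finset.range (j + 1),
      ⁅ρ x t, fluxAt α b u (j - k) x t⁆ * dressFactor z (ρ x t) ^ k =
      g * Q j - dressFlux g Q j * g := by
    simp only [Finset.smul_sum, ← smul_mul_assoc, ← dressFactor_lie, g]
    exact (mul_sub_dressFlux_mul _ Q j).symm
  have hu := ((isFlowSolution_iff h.commute).mp h.isFlowSolution).2 x t
  have hρ := h.hasDerivAt_snd x t
  have hlie := ((hρ.mul_const (Matrix.diagonal α)).sub
    (hρ.const_mul (Matrix.diagonal α))).const_smul (z - conj z)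
  refine (hu.add hlie).congr_deriv ?_
  rw [h.fluxAt_dressedPotential, dressFlux, ← neg_sub (conj z), neg_smul, smul_sub,
    ← smul_mul_assoc, ← mul_smul_comm, hg]
  simp only [Ring.lie_def, g, Q]
  noncomm_ring

theorem dressPencil_flowForm :
    dressPencil z (fun w => ρ w.1 w.2) (flowForm α b j u) (j + 1) =
      flowForm α b j (dressedPotential α z u ρ) := by
  funext k w
  rw [eq_planeForm (dressPencil z (fun w => ρ w.1 w.2) (flowForm α b j u) (j + 1) k w),
    dressPencil_apply, dressPencil_apply, flowForm, h.fluxAt_dressedPotential,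
    ← dressCoeff_eq_dressFlux]
  simp only [flowForm, planeForm_apply_fst, planeForm_apply_snd, dressedPotential]
  rw [dressCoeff_linearCoeff _ _ _ h.one_le, dressFactor_lie, ← neg_sub z, neg_smul, sub_neg_eq_add]

theorem isProjectionSystemSolution : IsProjectionSystemSolution α b j u z p ρ where
  smooth := matSmooth_iff_contDiff.mpr h.contDiff_projection
  deriv_x x t := by
    rw [matDeriv_eq (h.hasDerivAt_fst x t), dressFactor, mul_add, mul_smul_comm, mul_one,
      mul_smul_comm]
    simp only [Ring.lie_def, mul_add, add_mul, smul_mul_assoc, mul_smul_comm, smul_sub]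
    abel
  deriv_t x t := matDeriv_eq (h.hasDerivAt_snd x t)
  hermitian := h.star_eq
  idempotent := h.mul_self
  init := h.isDressingProjection.map_zero h.isSkewPencilSolution

end IsFlowDressing

end FlowDressing

section SimpleElement

open Filter Topology

variable {n : ℕ} {z ξ : ℂ} {ρ : CMat n}

theorem simpleElement_eq_smul (h : ξ ≠ conj z) (ρ : CMat n) :
    simpleElement z ρ ξ = (ξ - conj z)⁻¹ • (ξ • 1 - dressFactor z ρ) := by
  have hfactor : ξ • 1 - dressFactor z ρ = (ξ - conj z) • ρ + (ξ - z) • (1 - ρ) := by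
    rw [dressFactor]
    module
  rw [hfactor, smul_add, inv_smul_smul₀ (sub_ne_zero.mpr h), smul_smul, ← div_eq_inv_mul,
    simpleElement]

theorem simpleElement_conj_mul (hρ : ρ * ρ = ρ) (hz : ξ ≠ z) (hz' : ξ ≠ conj z) :
    simpleElement (conj z) ρ ξ * simpleElement z ρ ξ = 1 := by
  have hc : (ξ - conj z) / (ξ - z) * ((ξ - z) / (ξ - conj z)) = 1 := by
    rw [div_mul_div_cancel₀ (sub_ne_zero.mpr hz), div_self (sub_ne_zero.mpr hz')]
  have h : simpleElement (conj z) ρ ξ * simpleElement z ρ ξ =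
      ρ + ((ξ - conj z) / (ξ - z) * ((ξ - z) / (ξ - conj z))) • (1 - ρ) := by
    simp only [simpleElement, Complex.conj_conj, add_mul, mul_add, sub_mul, mul_sub,
      smul_mul_assoc, mul_smul_comm, one_mul, mul_one, hρ, sub_self, smul_zero]
    module
  rw [h, hc, one_smul, add_sub_cancel]

theorem conjTranspose_simpleElement_conj (hρ : ρ.conjTranspose = ρ) :
    (simpleElement z ρ (conj ξ)).conjTranspose = simpleElement (conj z) ρ ξ := by
  simp [simpleElement, hρ]

theorem isUnit_det_simpleElement (hρ : ρ * ρ = ρ) (hz : ξ ≠ z) (hz' : ξ ≠ conj z) :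
    IsUnit (simpleElement z ρ ξ).det :=
  Matrix.isUnit_det_of_left_inverse (simpleElement_conj_mul hρ hz hz')

theorem tendsto_simpleElement (z : ℂ) (ρ : CMat n) :
    Tendsto (simpleElement z ρ) (cocompact ℂ) (𝓝 1) := by
  rw [← Metric.cobounded_eq_cocompact]
  have hinv : Tendsto (fun ξ : ℂ => (ξ - conj z)⁻¹) (Bornology.cobounded ℂ) (𝓝 0) :=
    tendsto_inv₀_cobounded.comp (tendsto_sub_const_cobounded (conj z))
  have hquot : Tendsto (fun ξ : ℂ => (ξ - z) / (ξ - conj z)) (Bornology.cobounded ℂ) (𝓝 1) := by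
    have hlim : Tendsto (fun ξ => 1 + (conj z - z) * (ξ - conj z)⁻¹)
        (Bornology.cobounded ℂ) (𝓝 1) := by
      simpa using (hinv.const_mul (conj z - z)).const_add 1
    refine hlim.congr' ?_
    have hne : ∀ᶠ ξ : ℂ in Bornology.cobounded ℂ, ξ ≠ conj z :=
      Bornology.isBounded_def.mp Bornology.isBounded_singleton
    filter_upwards [hne] with ξ hξ
    have hξ' := sub_ne_zero.mpr hξ
    field_simp
    ring
  have hlim := (hquot.smul_const (1 - ρ)).const_add ρ
  rwa [one_smul, add_sub_cancel] at hlim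

theorem memGMinus_simpleElement (hs : ρ.conjTranspose = ρ) (hρ : ρ * ρ = ρ) :
    MemGMinus (simpleElement z ρ) := by
  refine ⟨Polynomial.X - Polynomial.C (conj z),
    Matrix.of fun i k => Polynomial.C ((1 : CMat n) i k) * Polynomial.X -
      Polynomial.C (dressFactor z ρ i k),
    Polynomial.X_sub_C_ne_zero _, fun ξ hξ => ?_, tendsto_simpleElement z ρ, fun ξ hξ hξ' => ?_⟩
  · simp only [Polynomial.eval_sub, Polynomial.eval_X, Polynomial.eval_C] at hξ ⊢
    rw [simpleElement_eq_smul (sub_ne_zero.mp hξ)]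
    congr 1
    ext i k
    simp [mul_comm ξ]
  · simp only [Polynomial.eval_sub, Polynomial.eval_X, Polynomial.eval_C, ← map_sub, ne_eq,
      map_eq_zero, sub_eq_zero] at hξ hξ'
    rw [conjTranspose_simpleElement_conj hs, simpleElement_conj_mul hρ hξ' hξ]

end SimpleElement

section Trivialization

open scoped Matrix.Norms.L2Operator
open Set

variable {n : ℕ} {z : ℂ}

namespace IsSkewPencilSolution

variable {W : Type*} [NormedAddCommGroup W] [NormedSpace ℝ W] {m : ℕ}
  {Ω : ℕ → W → W →L[ℝ] CMat n} {F : ℂ → W → CMat n} (h : IsSkewPencilSolution Ω m univ F)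

include h

theorem memGPlus [ProperSpace W] (w : W) : MemGPlus (F · w) :=
  ⟨fun i k => differentiable_pi.mp (differentiable_pi.mp (h.differentiable_param w) i) k,
    fun ξ => h.star_conj_mul (mem_univ ξ) w⟩

theorem isDressingProjection_hermProj (V : Submodule ℂ (EuclideanSpace ℂ (Fin n))) :
    IsDressingProjection F z (hermProj V)
      fun w => hermProj (imageSubspace (F z w).conjTranspose V) where
  isStarProjection := isStarProjection_hermProj V
  isRangeProjection w := isRangeProjection_hermProj V <| by
    simpa using h.mul_star_conj (mem_univ (conj z)) w

end IsSkewPencilSolution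

theorem isFlowDressing_hermProj {α : Fin n → ℂ} {b : CMat n} {j : ℕ} {u : ℝ → ℝ → CMat n}
    {E : ℝ → ℝ → ℂ → CMat n} (hj : 1 ≤ j) (ha : Matrix.diagonal α ∈ skewAdjoint (CMat n))
    (hb : b ∈ skewAdjoint (CMat n))
    (hab : ∃ p : Polynomial ℂ, b = Polynomial.aeval (Matrix.diagonal α : CMat n) p)
    (hu : IsFlowSolution α b j u) (hE : IsTrivialization α b j u E) (hz : z.im ≠ 0)
    (V : Submodule ℂ (EuclideanSpace ℂ (Fin n))) :
    IsFlowDressing α b j u E z (hermProj V)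
      fun x t => hermProj (imageSubspace (E x t z).conjTranspose V) := by
  have hcomm : Commute b (Matrix.diagonal α) := by
    obtain ⟨p, rfl⟩ := hab
    exact commute_aeval_self _ p
  have hF := hE.isSkewPencilSolution ((isFlowSolution_iff hcomm).mp hu).1 hj ha hb hcomm
  exact ⟨hj, ha, hb, hab, hu, hE, hz, hF.isDressingProjection_hermProj V⟩

theorem IsFlowDressing.exists_isTrivialization {α : Fin n → ℂ} {b : CMat n} {j : ℕ}
    {u : ℝ → ℝ → CMat n} {E : ℝ → ℝ → ℂ → CMat n} {p : CMat n} {ρ : ℝ → ℝ → CMat n}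
    (h : IsFlowDressing α b j u E z p ρ) :
    ∃ E', IsTrivialization α b j (dressedPotential α z u ρ) E' ∧ (∀ x t, MemGPlus (E' x t)) ∧
      ∀ x t ξ, ξ ≠ conj z →
        simpleElement z p ξ * E x t ξ = E' x t ξ * simpleElement z (ρ x t) ξ := by
  obtain ⟨F', hF', hfac⟩ := h.isDressingProjection.exists_intertwiner h.isSkewPencilSolution
  have hs := contDiff_dressPencil (z := z) h.contDiff_projection h.contDiff_flowForm (j + 1)
  rw [h.dressPencil_flowForm] at hF' hs
  refine ⟨fun x t ξ => F' ξ (x, t), isTrivialization_of_isFundamentalSolution h.one_le hs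
    fun ξ => hF'.solution ξ (mem_univ ξ), fun x t => hF'.memGPlus (x, t), fun x t ξ hξ => ?_⟩
  rw [simpleElement_eq_smul hξ, simpleElement_eq_smul hξ, smul_mul_assoc, mul_smul_comm]
  exact congrArg _ (hfac ξ (x, t))

end Trivialization

theorem corollary5p7 {n : ℕ} (α : Fin n → ℂ) (b : CMat n) (j : ℕ) (hj : 1 ≤ j)
    (ha : Matrix.diagonal α ∈ skewAdjoint (CMat n)) (hb : b ∈ skewAdjoint (CMat n))
    (hab : ∃ p : Polynomial ℂ, b = Polynomial.aeval (Matrix.diagonal α : CMat n) p)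
    (u : ℝ → ℝ → CMat n) (hu : IsFlowSolution α b j u)
    (E : ℝ → ℝ → ℂ → CMat n) (hE : IsTrivialization α b j u E)
    (z : ℂ) (hz : z.im ≠ 0) (V : Submodule ℂ (EuclideanSpace ℂ (Fin n)))
    (π : CMat n) (hπ : π = hermProj V)
    (π' : ℝ → ℝ → CMat n)
    (hπ' : ∀ x t, π' x t = hermProj (imageSubspace (E x t z).conjTranspose V))
    (u' : ℝ → ℝ → CMat n)
    (hu' : ∀ x t, u' x t = u x t + (z - conj z) • ⁅π' x t, (Matrix.diagonal α : CMat n)⁆) :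
    IsFlowSolution α b j u' ∧
    IsProjectionSystemSolution α b j u z π π' ∧
    ∃ E' : ℝ → ℝ → ℂ → CMat n,
      (∀ x t ξ, ξ ≠ z → ξ ≠ conj z →
        E' x t ξ = simpleElement z π ξ * E x t ξ * (simpleElement z (π' x t) ξ)⁻¹) ∧
      IsTrivialization α b j u' E' ∧
      (∀ x t, MemGPlus (E' x t)) ∧
      (∀ x t, MemGMinus (simpleElement z (π' x t))) ∧
      ∀ x t ξ, ξ ≠ conj z →
        simpleElement z π ξ * E x t ξ = E' x t ξ * simpleElement z (π' x t) ξ := by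
  obtain rfl : π' = fun x t => hermProj (imageSubspace (E x t z).conjTranspose V) :=
    funext₂ hπ'
  obtain rfl : u' = dressedPotential α z u _ := funext₂ hu'
  subst hπ
  have h := isFlowDressing_hermProj hj ha hb hab hu hE hz V
  obtain ⟨E', hE', hplus, hfac⟩ := h.exists_isTrivialization
  refine ⟨h.isFlowSolution_dressedPotential, h.isProjectionSystemSolution, E',
    fun x t ξ hξ hξ' => ?_, hE', hplus,
    fun x t => memGMinus_simpleElement (h.star_eq x t) (h.mul_self x t), hfac⟩
  rw [hfac x t ξ hξ',
    Matrix.mul_nonsing_inv_cancel_right _ _ (isUnit_det_simpleElement (h.mul_self x t) hξ hξ')]
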